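/- Let $(M,g)$ be a closed (compact, without boundary) smooth Riemannian manifold with volume measure $d\nu$, let $f\in C^{2}(M)$ and $d\mu=e^{-f}d\nu$. Let $1<p<\infty$, $a<b$, $m\in\mathbb{N}$, and let $u:M\times[a,b]\to\mathbb{R}^m$ be smooth. Write $|\nabla u|^2=\sum_k|\nabla u_k|^2$ and let $$\Delta_{f,p}u=\mathrm{div}_f\big(|\nabla u|^{p-2}\nabla u\big)=e^{f}\,\mathrm{div}\big(e^{-f}|\nabla u|^{p-2}\nabla u\big)$$ (componentwise) be the weighted $p$-Laplacian; if $1<p<2$, assume that for each $t\in[a,b]$ the field $|\nabla u|^{p-2}\nabla u$ (set equal to $0$ where $\nabla u=0$) is $C^1$ on $M$, so that $\Delta_{f,p}u$ is defined pointwise (for $p\ge 2$ this is automatic). For $t\in[a,b]$ put $$D_p(t)=\int_M\langle u,\Delta_{f,p}u\rangle\,d\mu,\qquad I_p(t)=\int_M|u|^p\,d\mu,\qquad U_p(t)=\frac{D_p(t)}{I_p(t)}.$$ Let $\psi:[a,b]\to\mathbb{R}$ be a function, and suppose that $$\big||u|^{p-2}u_t-\Delta_{f,p}u\big|\le\psi(t)\,|u|^{p-1}\Big(1+|u|^{-\frac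 p2}\sqrt{|\nabla u|^{p}}\Big)$$ at all points $(x,t)\in M\times[a,b]$ with $u(x,t)\neq0$. Then, for every $t\in[a,b]$ such that $u(\cdot,t)\not\equiv0$, one has $I_p(t)>0$ and $D_p(t)=-\int_M|\nabla u|^p\,d\mu$, the functions $U_p$, $\log(1-U_p)$ and $\log I_p$ are differentiable at $t$ (one-sidedly at the endpoints $a$ and $b$), and $$U_p'(t)\ge\frac p2\,\psi^2(t)\,[U_p(t)-1],\qquad \psi^2(t)\ge\frac2p\,\big[\log(1-U_p(t))\big]',$$ $$[\log I_p(t)]'\ge p\Big(1+\frac{\psi(t)}2\Big)U_p(t)-\frac{3p}2\,\psi(t).$$ -/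

import Mathlib

open MeasureTheory Set
open scoped Manifold ContDiff

noncomputable section

namespace WeightedPHeat

/-- A smooth Riemannian metric on the `n`-dimensional manifold `M` (Mathlib's notion). -/
abbrev Metric (n : ℕ) (M : Type*) [TopologicalSpace M]
    [ChartedSpace (EuclideanSpace ℝ (Fin n)) M] [IsManifold (𝓡 n) ∞ M] :=
  Bundle.ContMDiffRiemannianMetric (𝓡 n) ∞ (EuclideanSpace ℝ (Fin n))
    (fun x : M => TangentSpace (𝓡 n) x)

variable {n m : ℕ} {M : Type*} [TopologicalSpace M]
  [ChartedSpace (EuclideanSpace ℝ (Fin n)) M] [IsManifold (𝓡 n) ∞ M]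

/-! ### Riemannian volume -/

/-- The coordinate vector `∂_i` of the chart at `c`, at the point with coordinates `y`. -/
def coordVec (c : M) (y : EuclideanSpace ℝ (Fin n)) (i : Fin n) :
    TangentSpace (𝓡 n) ((extChartAt (𝓡 n) c).symm y) :=
  mfderiv 𝓘(ℝ, EuclideanSpace ℝ (Fin n)) (𝓡 n) (extChartAt (𝓡 n) c).symm y
    (EuclideanSpace.single i (1 : ℝ))

/-- The matrix `g_{ij} = g(∂_i, ∂_j)` of the metric in the chart at `c`. -/
def gram (g : Metric n M) (c : M) (y : EuclideanSpace ℝ (Fin n)) : Matrix (Fin n) (Fin n) ℝ :=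
  Matrix.of fun i j =>
    g.inner ((extChartAt (𝓡 n) c).symm y) (coordVec c y i) (coordVec c y j)

/-- The Riemannian density `√(det g_{ij})` in the chart at `c`. -/
def volDensity (g : Metric n M) (c : M) (y : EuclideanSpace ℝ (Fin n)) : ℝ :=
  √(gram g c y).det

/-- The measure `√(det g_{ij}) dy` of the chart at `c`, carried over to the chart domain in `M`. -/
def localVolume [MeasurableSpace M] (g : Metric n M) (c : M) : Measure M :=
  ((volume.restrict (extChartAt (𝓡 n) c).target).withDensity
    (fun y => ENNReal.ofReal (volDensity g c y))).map (extChartAt (𝓡 n) c).symm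

/-- The Riemannian volume measure `ν` of `(M, g)`. The measures `√(det g_{ij}) dy` of two charts
agree on the overlap of the chart domains, so the least measure that dominates all of them is the
one that restricts to each of them on its chart domain. -/
def riemannianVolume [MeasurableSpace M] (g : Metric n M) : Measure M :=
  ⨆ c : M, localVolume g c

/-- The weighted volume `dμ = e^{-f} dν`. -/
def weightedVolume [MeasurableSpace M] (g : Metric n M) (f : M → ℝ) : Measure M :=
  (riemannianVolume g).withDensity (fun x => ENNReal.ofReal (Real.exp (-f x)))

/-! ### Gradient and weighted divergence -/

instance (x : M) : FiniteDimensional ℝ (TangentSpace (𝓡 n) x) :=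
  inferInstanceAs (FiniteDimensional ℝ (EuclideanSpace ℝ (Fin n)))

/-- The inner product `g_x` on `T_x M`, as a bilinear form. -/
def metricForm (g : Metric n M) (x : M) : LinearMap.BilinForm ℝ (TangentSpace (𝓡 n) x) :=
  LinearMap.mk₂ ℝ (fun v w => g.inner x v w) (by simp) (by simp) (by simp) (by simp)

theorem metricForm_apply (g : Metric n M) (x : M) (v w : TangentSpace (𝓡 n) x) :
    metricForm g x v w = g.inner x v w := rfl

theorem metricForm_nondegenerate (g : Metric n M) (x : M) : (metricForm g x).Nondegenerate := by
  constructor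
  · intro v hv
    by_contra h
    exact (g.pos x v h).ne' (hv v)
  · intro v hv
    by_contra h
    exact (g.pos x v h).ne' (hv v)

/-- The gradient `∇h` of a real function: `g(∇h, v) = dh(v)` for every tangent vector `v`. -/
def grad (g : Metric n M) (h : M → ℝ) (x : M) : TangentSpace (𝓡 n) x :=
  ((metricForm g x).toDual (metricForm_nondegenerate g x)).symm
    (show TangentSpace (𝓡 n) x →L[ℝ] ℝ from mfderiv (𝓡 n) 𝓘(ℝ, ℝ) h x).toLinearMap

theorem inner_grad (g : Metric n M) (h : M → ℝ) (x : M) (v : TangentSpace (𝓡 n) x) :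
    g.inner x (grad g h x) v = mfderiv (𝓡 n) 𝓘(ℝ, ℝ) h x v := by
  rw [← metricForm_apply, grad, LinearMap.BilinForm.apply_toDual_symm_apply]
  rfl

/-- `|∇u| = (∑_k |∇u_k|²)^{1/2}` for a vector valued map `u = (u_1, …, u_m)`. -/
def gradNorm (g : Metric n M) (u : M → EuclideanSpace ℝ (Fin m)) (x : M) : ℝ :=
  √(∑ k, g.inner x (grad g (fun z => u z k) x) (grad g (fun z => u z k) x))

/-- The components `X^i` of the vector field `X` in the chart at `c`, as functions of the
coordinates `y`. -/
def coordField (c : M) (X : (x : M) → TangentSpace (𝓡 n) x) (y : EuclideanSpace ℝ (Fin n)) :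
    EuclideanSpace ℝ (Fin n) :=
  mfderiv (𝓡 n) 𝓘(ℝ, EuclideanSpace ℝ (Fin n)) (extChartAt (𝓡 n) c)
    ((extChartAt (𝓡 n) c).symm y) (X ((extChartAt (𝓡 n) c).symm y))

/-- The Riemannian divergence `div X = (det g)^{-1/2} ∑_i ∂_i ((det g)^{1/2} X^i)`, computed at `q`
in the chart at `q`. -/
def divergence (g : Metric n M) (X : (x : M) → TangentSpace (𝓡 n) x) (q : M) : ℝ :=
  (volDensity g q (extChartAt (𝓡 n) q q))⁻¹ *
    ∑ i, fderiv ℝ (fun y => volDensity g q y * coordField q X y i) (extChartAt (𝓡 n) q q)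
      (EuclideanSpace.single i (1 : ℝ))

/-- The weighted divergence `div_f X = e^f div (e^{-f} X)`. -/
def weightedDiv (g : Metric n M) (f : M → ℝ) (X : (x : M) → TangentSpace (𝓡 n) x) (q : M) : ℝ :=
  Real.exp (f q) * divergence g (fun x => Real.exp (-f x) • X x) q

/-- The `k`-th component `|∇u|^{p-2} ∇u_k` of the flux (it is `0` where `∇u = 0`). -/
def flux (g : Metric n M) (p : ℝ) (u : M → EuclideanSpace ℝ (Fin m)) (k : Fin m) (x : M) :
    TangentSpace (𝓡 n) x :=
  gradNorm g u x ^ (p - 2) • grad g (fun z => u z k) x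

/-- The weighted `p`-Laplacian `Δ_{f,p} u = div_f (|∇u|^{p-2} ∇u)`, componentwise. -/
def pLaplacian (g : Metric n M) (f : M → ℝ) (p : ℝ) (u : M → EuclideanSpace ℝ (Fin m)) (q : M) :
    EuclideanSpace ℝ (Fin m) :=
  WithLp.toLp 2 (fun k => weightedDiv g f (flux g p u k) q)

/-! ### The `p`-parabolic frequency -/

/-- `D_p = ∫ ⟨u, Δ_{f,p} u⟩ dμ`. -/
def energy [MeasurableSpace M] (g : Metric n M) (f : M → ℝ) (p : ℝ)
    (u : M → EuclideanSpace ℝ (Fin m)) : ℝ :=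
  ∫ x, inner ℝ (u x) (pLaplacian g f p u x) ∂(weightedVolume g f)

/-- `I_p = ∫ |u|^p dμ`. -/
def mass [MeasurableSpace M] (g : Metric n M) (f : M → ℝ) (p : ℝ)
    (u : M → EuclideanSpace ℝ (Fin m)) : ℝ :=
  ∫ x, ‖u x‖ ^ p ∂(weightedVolume g f)

/-- The `p`-parabolic frequency `U_p = D_p / I_p`. -/
def frequency [MeasurableSpace M] (g : Metric n M) (f : M → ℝ) (p : ℝ)
    (u : M → EuclideanSpace ℝ (Fin m)) : ℝ :=
  energy g f p u / mass g f p u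

end WeightedPHeat

end

set_option linter.unusedSectionVars false

/-! Write L = Δ_{f,p} u, w = |u|^{p-2}, N = |∇u|, and let E = w u_t - L be the error in the
equation. Integration by parts gives D = -∫ N^p dμ. Differentiating this in time and integrating by
parts once more gives D' = p ∫ ⟨u_t, L⟩ dμ, while I' = p ∫ w ⟨u, u_t⟩ dμ. Hence U' = (p/I) (∫ ⟨u_t,
L⟩ dμ - U ∫ w ⟨u, u_t⟩ dμ).

The central estimate is a completed square (`le_inner_sub_of_norm_sub_le`). For every real l,
substituting w u_t = L + E gives w (⟨u_t, L⟩ - l (w ⟨u, u_t⟩ + ⟨u, L⟩) + l² |u|^p) = |L + E/2 - l w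
u|² - |E|²/4, and the differential inequality gives |E|² ≤ 2 ψ² w (|u|^p + N^p). Dividing by w,
integrating and taking l = U makes the terms with ⟨u, L⟩ and l² cancel, which leaves U' ≥ (p/2) ψ²
(U - 1). Since U ≤ 0, dividing by 1 - U yields the bound on the derivative of log(1 - U). The bound
on (log I)' follows from |⟨u, E⟩| ≤ ψ (3/2 |u|^p + 1/2 N^p) (`inner_sub_le_of_norm_sub_le`).

The differential inequality says nothing where u = 0. There ∇u = 0 almost everywhere, so the flux
vanishes, and the divergence of a C^1 field vanishes almost everywhere on the zero set of the field.
Thus L = 0 almost everywhere on {u = 0} (`ae_pLaplacian_eq_zero`).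

Three analytic facts support this. The divergence theorem (`integral_mul_weightedDiv`) needs the
volume to restrict correctly to charts and the divergence to be independent of the chart. For p ≥ 2
the flux is C^1 even where ∇u = 0 (`isC1Field_flux`). The functions |∇u|^p and |u|^p are
differentiable in time up to the endpoints, with uniformly bounded derivative, also for p < 2 at the
zeros of ∇u and of u, so one may differentiate under the integral. -/

namespace WeightedPHeat

open Filter Topology Bundle
variable {n m : ℕ} {M : Type*} [TopologicalSpace M]
  [ChartedSpace (EuclideanSpace ℝ (Fin n)) M] [IsManifold (𝓡 n) ∞ M]

/-! ### The coordinate frame of a chart -/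

local notation "𝔼" => EuclideanSpace ℝ (Fin n)

/-- The differential of the inverse of the chart at `c`. -/
noncomputable def frameMap (c : M) (y : 𝔼) :
    𝔼 →L[ℝ] TangentSpace (𝓡 n) ((extChartAt (𝓡 n) c).symm y) :=
  mfderiv 𝓘(ℝ, 𝔼) (𝓡 n) (extChartAt (𝓡 n) c).symm y

/-- The differential of the chart at `c`. -/
noncomputable def coframeMap (c : M) (x : M) : TangentSpace (𝓡 n) x →L[ℝ] 𝔼 :=
  mfderiv (𝓡 n) 𝓘(ℝ, 𝔼) (extChartAt (𝓡 n) c) x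

theorem coordField_eq (c : M) (X : (x : M) → TangentSpace (𝓡 n) x) (y : 𝔼) :
    coordField c X y = coframeMap c ((extChartAt (𝓡 n) c).symm y)
      (X ((extChartAt (𝓡 n) c).symm y)) := rfl

theorem frameMap_eq_mfderivWithin (c : M) (y : 𝔼) :
    frameMap c y = mfderivWithin 𝓘(ℝ, 𝔼) (𝓡 n) (extChartAt (𝓡 n) c).symm (range (𝓡 n)) y := by
  simp only [frameMap, ModelWithCorners.range_eq_univ, mfderivWithin_univ]
  rfl

theorem coframeMap_frameMap {c : M} {y : 𝔼} (hy : y ∈ (extChartAt (𝓡 n) c).target) (v : 𝔼) :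
    coframeMap c ((extChartAt (𝓡 n) c).symm y) (frameMap c y v) = v := by
  have := mfderiv_extChartAt_comp_mfderivWithin_extChartAt_symm (I := 𝓡 n) hy
  rw [← frameMap_eq_mfderivWithin] at this
  exact DFunLike.congr_fun this v

theorem frameMap_coframeMap {c : M} {y : 𝔼} (hy : y ∈ (extChartAt (𝓡 n) c).target)
    (v : TangentSpace (𝓡 n) ((extChartAt (𝓡 n) c).symm y)) :
    frameMap c y (coframeMap c ((extChartAt (𝓡 n) c).symm y) v) = v := by
  have := mfderivWithin_extChartAt_symm_comp_mfderiv_extChartAt (I := 𝓡 n) hy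
  rw [← frameMap_eq_mfderivWithin] at this
  exact DFunLike.congr_fun this v

theorem contMDiffOn_extChartAt_symm' (c : M) :
    ContMDiffOn 𝓘(ℝ, 𝔼) (𝓡 n) ∞ (extChartAt (𝓡 n) c).symm (extChartAt (𝓡 n) c).target :=
  contMDiffOn_extChartAt_symm c

theorem contMDiffAt_extChartAt_symm {c : M} {y : 𝔼} (hy : y ∈ (extChartAt (𝓡 n) c).target) :
    ContMDiffAt 𝓘(ℝ, 𝔼) (𝓡 n) ∞ (extChartAt (𝓡 n) c).symm y :=
  (contMDiffOn_extChartAt_symm c).contMDiffAt ((isOpen_extChartAt_target c).mem_nhds hy)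

theorem symm_mem_source {c : M} {y : 𝔼} (hy : y ∈ (extChartAt (𝓡 n) c).target) :
    (extChartAt (𝓡 n) c).symm y ∈ (chartAt 𝔼 c).source := by
  rw [← extChartAt_source (𝓡 n)]
  exact (extChartAt (𝓡 n) c).map_target hy

theorem trivializationAt_snd {c x : M} (hx : x ∈ (chartAt 𝔼 c).source)
    (v : TangentSpace (𝓡 n) x) :
    (trivializationAt 𝔼 (TangentSpace (𝓡 n)) c (TotalSpace.mk x v)).2 = coframeMap c x v := by
  rw [coframeMap, ← TangentBundle.continuousLinearMapAt_trivializationAt hx,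
    Trivialization.continuousLinearMapAt_apply, Trivialization.linearMapAt_apply, if_pos (by simpa using hx)]

/-- A vector field along the inverse of a chart is `C^k` iff its components are. -/
theorem contMDiffOn_chart_field_iff {k : WithTop ℕ∞} (hk : k ≤ ∞) (c : M)
    {U : Set 𝔼} (hU : U ⊆ (extChartAt (𝓡 n) c).target)
    (V : (y : 𝔼) → TangentSpace (𝓡 n) ((extChartAt (𝓡 n) c).symm y)) :
    ContMDiffOn 𝓘(ℝ, 𝔼) (𝓡 n).tangent k
      (fun y => TotalSpace.mk' 𝔼 ((extChartAt (𝓡 n) c).symm y) (V y)) U ↔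
    ContDiffOn ℝ k (fun y => coframeMap c ((extChartAt (𝓡 n) c).symm y) (V y)) U := by
  have : ContMDiffVectorBundle k 𝔼 (TangentSpace (𝓡 n) : M → Type _) (𝓡 n) :=
    ContMDiffVectorBundle.of_le (n := ∞) hk
  rw [ModelWithCorners.tangent, (trivializationAt 𝔼 (TangentSpace (𝓡 n)) c).contMDiffOn_iff]
  · rw [← contMDiffOn_iff_contDiffOn]
    constructor
    · intro h
      refine h.2.congr fun y hy => ?_
      exact (trivializationAt_snd (symm_mem_source (hU hy)) _).symm
    · intro h
      refine ⟨((contMDiffOn_extChartAt_symm' c).of_le hk).mono hU, h.congr fun y hy => ?_⟩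
      exact (trivializationAt_snd (symm_mem_source (hU hy)) _)
  · intro y hy
    simpa [Trivialization.mem_source] using symm_mem_source (hU hy)

theorem contMDiffOn_coordVec (c : M) (i : Fin n) :
    ContMDiffOn 𝓘(ℝ, 𝔼) (𝓡 n).tangent ∞
      (fun y => TotalSpace.mk' 𝔼 ((extChartAt (𝓡 n) c).symm y) (coordVec c y i))
      (extChartAt (𝓡 n) c).target := by
  rw [contMDiffOn_chart_field_iff le_rfl c subset_rfl]
  refine (contDiffOn_const (c := EuclideanSpace.single i (1 : ℝ))).congr fun y hy => ?_
  exact coframeMap_frameMap hy _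

/-- A vector field is `C^k` iff its components in all charts are. -/
theorem contMDiff_field_iff {k : WithTop ℕ∞} (hk : k ≤ ∞) (X : (x : M) → TangentSpace (𝓡 n) x) :
    ContMDiff (𝓡 n) (𝓡 n).tangent k (fun x => (⟨x, X x⟩ : TangentBundle (𝓡 n) M)) ↔
      ∀ c : M, ContDiffOn ℝ k (coordField c X) (extChartAt (𝓡 n) c).target := by
  constructor
  · intro h c
    refine (contMDiffOn_chart_field_iff hk c subset_rfl
      (fun y => X ((extChartAt (𝓡 n) c).symm y))).1 ?_
    exact h.comp_contMDiffOn ((contMDiffOn_extChartAt_symm' c).of_le hk)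
  · intro h x
    have : IsManifold (𝓡 n) k M := IsManifold.of_le hk
    have h1 := (contMDiffOn_chart_field_iff hk x subset_rfl
      (fun y => X ((extChartAt (𝓡 n) x).symm y))).2 (h x)
    have h2 := (h1.contMDiffAt ((isOpen_extChartAt_target x).mem_nhds
      (mem_extChartAt_target x)))
    have h3 := h2.comp x (contMDiffAt_extChartAt' (I := 𝓡 n) (n := k) (mem_chart_source _ x))
    refine h3.congr_of_eventuallyEq ?_
    filter_upwards [extChartAt_source_mem_nhds (I := 𝓡 n) x] with z hz
    have hz' := (extChartAt (𝓡 n) x).left_inv hz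
    simp only [Function.comp]
    rw [hz']

/-! ### The metric in a chart -/

theorem contDiffOn_gram (g : Metric n M) (c : M) (i j : Fin n) :
    ContDiffOn ℝ ∞ (fun y => gram g c y i j) (extChartAt (𝓡 n) c).target := by
  rw [← contMDiffOn_iff_contDiffOn]
  -- The metric is smooth as a section of a bundle of bilinear forms. Viewing the number g_{ij} as a
  -- section of the trivial line bundle allows it to be evaluated on the smooth coordinate fields.
  have h1 : ContMDiffOn 𝓘(ℝ, 𝔼) ((𝓡 n).prod 𝓘(ℝ, ℝ)) ∞
      (fun y => TotalSpace.mk' ℝ (E := Bundle.Trivial M ℝ) ((extChartAt (𝓡 n) c).symm y)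
        (g.inner ((extChartAt (𝓡 n) c).symm y) (coordVec c y i) (coordVec c y j)))
      (extChartAt (𝓡 n) c).target := by
    apply ContMDiffOn.clm_bundle_apply₂ (F₁ := 𝔼) (F₂ := 𝔼)
    · exact g.contMDiff.comp_contMDiffOn (contMDiffOn_extChartAt_symm' c)
    · exact contMDiffOn_coordVec c i
    · exact contMDiffOn_coordVec c j
  intro y hy
  have h2 := h1 y hy
  rw [contMDiffWithinAt_totalSpace] at h2
  exact h2.2

/-- The metric in the chart at `c`, as a bilinear form on the coordinate space. -/
noncomputable def metricCoord (g : Metric n M) (c : M) (y : 𝔼) : 𝔼 →L[ℝ] 𝔼 →L[ℝ] ℝ :=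
  LinearMap.toContinuousBilinearMap
    (((metricForm g ((extChartAt (𝓡 n) c).symm y)).compl₁₂
      (frameMap c y).toLinearMap (frameMap c y).toLinearMap))

theorem metricCoord_apply (g : Metric n M) (c : M) (y v w : 𝔼) :
    metricCoord g c y v w =
      g.inner ((extChartAt (𝓡 n) c).symm y) (frameMap c y v) (frameMap c y w) := rfl

theorem metricCoord_pos (g : Metric n M) {c : M} {y : 𝔼}
    (hy : y ∈ (extChartAt (𝓡 n) c).target) {v : 𝔼} (hv : v ≠ 0) :
    0 < metricCoord g c y v v := by
  refine g.pos _ _ fun h => hv ?_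
  rw [← coframeMap_frameMap hy v]
  exact (congrArg _ h).trans (map_zero _)

/-- The forms v_i w_j are constant, so smoothness of the operator-valued map `metricCoord` reduces
to smoothness of the entries g_{ij}. -/
theorem metricCoord_eq_sum (g : Metric n M) (c : M) (y : 𝔼) :
    metricCoord g c y = ∑ i, ∑ j, gram g c y i j •
      ((EuclideanSpace.proj i : 𝔼 →L[ℝ] ℝ).smulRight (EuclideanSpace.proj j : 𝔼 →L[ℝ] ℝ)) := by
  have key : ∀ v w : 𝔼, metricCoord g c y v w = ∑ i, ∑ j, gram g c y i j * (v i * w j) := by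
    intro v w
    have hv : v = ∑ i, v i • EuclideanSpace.single i (1 : ℝ) := by
      ext k; simp [Finset.sum_apply, Pi.single_apply]
    have hw : w = ∑ i, w i • EuclideanSpace.single i (1 : ℝ) := by
      ext k; simp [Finset.sum_apply, Pi.single_apply]
    conv_lhs => rw [hv, hw]
    simp only [map_sum, map_smul, sum_apply, smul_apply,
      smul_eq_mul, Finset.mul_sum]
    rw [Finset.sum_comm]
    refine Finset.sum_congr rfl fun i _ => Finset.sum_congr rfl fun j _ => ?_
    have : gram g c y i j = metricCoord g c y (EuclideanSpace.single i 1)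
      (EuclideanSpace.single j 1) := rfl
    rw [this]; ring
  ext v w
  rw [key]
  simp

theorem contDiffOn_sum_smul_const {V W ι κ : Type*} [NormedAddCommGroup V] [NormedSpace ℝ V]
    [NormedAddCommGroup W] [NormedSpace ℝ W] [Fintype ι] [Fintype κ] {k : WithTop ℕ∞}
    {a : V → ι → κ → ℝ} {s : Set V} (ha : ∀ i j, ContDiffOn ℝ k (fun y => a y i j) s)
    (w : ι → κ → W) : ContDiffOn ℝ k (fun y => ∑ i, ∑ j, a y i j • w i j) s :=
  ContDiffOn.sum fun i _ => ContDiffOn.sum fun j _ => (ha i j).smul contDiffOn_const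

theorem contDiffOn_metricCoord (g : Metric n M) (c : M) :
    ContDiffOn ℝ ∞ (metricCoord g c) (extChartAt (𝓡 n) c).target := by
  have : metricCoord g c = fun y => _ := funext fun y => metricCoord_eq_sum g c y
  rw [this]
  exact contDiffOn_sum_smul_const (contDiffOn_gram g c) _

theorem posDef_gram (g : Metric n M) {c : M} {y : 𝔼}
    (hy : y ∈ (extChartAt (𝓡 n) c).target) : (gram g c y).PosDef := by
  refine Matrix.PosDef.of_dotProduct_mulVec_pos ?_ ?_
  · ext i j
    simp only [Matrix.conjTranspose_apply, star_trivial, gram, Matrix.of_apply]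
    exact g.symm _ _ _
  · intro v hv
    have h := metricCoord_pos g hy (v := WithLp.toLp 2 v) (by simpa using hv)
    rw [metricCoord_eq_sum] at h
    simp only [sum_apply, smul_apply,
      ContinuousLinearMap.smulRight_apply, smul_eq_mul] at h
    refine h.trans_eq ?_
    simp only [dotProduct, Matrix.mulVec, Finset.mul_sum]
    refine Finset.sum_congr rfl fun i _ => Finset.sum_congr rfl fun j _ => ?_
    simp
    ring

theorem gram_det_pos (g : Metric n M) {c : M} {y : 𝔼}
    (hy : y ∈ (extChartAt (𝓡 n) c).target) : 0 < (gram g c y).det :=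
  (posDef_gram g hy).det_pos

theorem volDensity_pos (g : Metric n M) {c : M} {y : 𝔼}
    (hy : y ∈ (extChartAt (𝓡 n) c).target) : 0 < volDensity g c y :=
  Real.sqrt_pos.2 (gram_det_pos g hy)

theorem contDiffOn_volDensity (g : Metric n M) (c : M) :
    ContDiffOn ℝ ∞ (volDensity g c) (extChartAt (𝓡 n) c).target := by
  have h : ContDiffOn ℝ ∞ (fun y => (gram g c y).det) (extChartAt (𝓡 n) c).target := by
    simp only [Matrix.det_apply]
    refine ContDiffOn.sum fun σ _ => ContDiffOn.const_smul _ ?_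
    exact contDiffOn_prod fun i _ => contDiffOn_gram g c _ _
  exact h.sqrt fun y hy => (gram_det_pos g hy).ne'

end WeightedPHeat

namespace WeightedPHeat

open Filter Topology Bundle
variable {n m : ℕ} {M : Type*} [TopologicalSpace M]
  [ChartedSpace (EuclideanSpace ℝ (Fin n)) M] [IsManifold (𝓡 n) ∞ M]

local notation "𝔼" => EuclideanSpace ℝ (Fin n)

/-! ### Change of charts -/

theorem inner_eq_metricCoord (g : Metric n M) {c x : M} (hx : x ∈ (extChartAt (𝓡 n) c).source)
    (v w : TangentSpace (𝓡 n) x) :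
    g.inner x v w =
      metricCoord g c (extChartAt (𝓡 n) c x) (coframeMap c x v) (coframeMap c x w) := by
  obtain ⟨y, hy, rfl⟩ : ∃ y ∈ (extChartAt (𝓡 n) c).target, (extChartAt (𝓡 n) c).symm y = x :=
    ⟨_, (extChartAt (𝓡 n) c).map_source hx, (extChartAt (𝓡 n) c).left_inv hx⟩
  rw [(extChartAt (𝓡 n) c).right_inv hy, metricCoord_apply, frameMap_coframeMap hy,
    frameMap_coframeMap hy]

/-- The differential of the change of coordinates from the chart at `c'` to the chart at `c`. -/
noncomputable def coordChangeMap (c' c : M) (y : 𝔼) : 𝔼 →L[ℝ] 𝔼 :=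
  (coframeMap c ((extChartAt (𝓡 n) c').symm y)).comp (frameMap c' y)

theorem hasFDerivAt_coordChange {c c' : M} {y : 𝔼} (hy : y ∈ (extChartAt (𝓡 n) c').target)
    (hyc : (extChartAt (𝓡 n) c').symm y ∈ (extChartAt (𝓡 n) c).source) :
    HasFDerivAt (fun z => extChartAt (𝓡 n) c ((extChartAt (𝓡 n) c').symm z))
      (coordChangeMap c' c y) y := by
  refine hasMFDerivAt_iff_hasFDerivAt.1 ?_
  have h1 : HasMFDerivAt 𝓘(ℝ, 𝔼) (𝓡 n) (extChartAt (𝓡 n) c').symm y (frameMap c' y) :=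
    ((contMDiffAt_extChartAt_symm hy).mdifferentiableAt (by simp)).hasMFDerivAt
  have h2 : HasMFDerivAt (𝓡 n) 𝓘(ℝ, 𝔼) (extChartAt (𝓡 n) c) ((extChartAt (𝓡 n) c').symm y)
      (coframeMap c ((extChartAt (𝓡 n) c').symm y)) :=
    (mdifferentiableAt_extChartAt (by rwa [extChartAt_source] at hyc)).hasMFDerivAt
  exact h2.comp y h1

/-- The two Gram matrices are congruent, G' = Jᵀ G J with J the Jacobian of the transition map, so
their determinants differ by the factor (det J)². -/
theorem volDensity_coordChange (g : Metric n M) {c c' : M} {y : 𝔼}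
    (hyc : (extChartAt (𝓡 n) c').symm y ∈ (extChartAt (𝓡 n) c).source) :
    volDensity g c' y = |(coordChangeMap c' c y).det| *
      volDensity g c (extChartAt (𝓡 n) c ((extChartAt (𝓡 n) c').symm y)) := by
  set b := (EuclideanSpace.basisFun (Fin n) ℝ).toBasis
  set J : Matrix (Fin n) (Fin n) ℝ := LinearMap.toMatrix b b (coordChangeMap c' c y).toLinearMap
  have hJ : ∀ k i, J k i = coordChangeMap c' c y (EuclideanSpace.single i 1) k := fun k i => by
    simp [J, b, LinearMap.toMatrix_apply]
  have h1 : gram g c' y = J.transpose *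
      gram g c (extChartAt (𝓡 n) c ((extChartAt (𝓡 n) c').symm y)) * J := by
    ext i j
    have h2 : gram g c' y i j = metricCoord g c
        (extChartAt (𝓡 n) c ((extChartAt (𝓡 n) c').symm y))
        (coordChangeMap c' c y (EuclideanSpace.single i 1))
        (coordChangeMap c' c y (EuclideanSpace.single j 1)) :=
      inner_eq_metricCoord g hyc _ _
    rw [h2, metricCoord_eq_sum]
    simp only [sum_apply, smul_apply, ContinuousLinearMap.smulRight_apply, smul_eq_mul,
      Matrix.mul_apply, Matrix.transpose_apply, hJ, Finset.sum_mul]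
    rw [Finset.sum_comm]
    refine Finset.sum_congr rfl fun l _ => Finset.sum_congr rfl fun k _ => ?_
    simp only [EuclideanSpace.coe_proj]
    ring
  have hdet : J.det = (coordChangeMap c' c y).det := LinearMap.det_toMatrix b _
  rw [volDensity, volDensity, h1, Matrix.det_mul, Matrix.det_mul, Matrix.det_transpose, hdet,
    show ∀ a b : ℝ, a * b * a = a ^ 2 * b by intros; ring, Real.sqrt_mul (sq_nonneg _),
    Real.sqrt_sq_eq_abs]

/-! ### The Riemannian volume in a chart -/

section Volume

variable [MeasurableSpace M] [BorelSpace M]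

theorem measurableSet_chart_preimage (c : M) {A : Set M} (hA : MeasurableSet A) :
    MeasurableSet ((extChartAt (𝓡 n) c).symm ⁻¹' A ∩ (extChartAt (𝓡 n) c).target) := by
  classical
  -- The inverse chart is continuous only on its target. Replacing it by a constant elsewhere gives
  -- a globally measurable map with the same preimages inside the target.
  have h : Measurable ((extChartAt (𝓡 n) c).target.piecewise (extChartAt (𝓡 n) c).symm
      (fun _ => c)) :=
    ContinuousOn.measurable_piecewise (continuousOn_extChartAt_symm c) continuousOn_const
      (isOpen_extChartAt_target c).measurableSet
  have h2 := (h hA).inter (isOpen_extChartAt_target (I := 𝓡 n) c).measurableSet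
  convert h2 using 1
  ext y
  simp only [mem_inter_iff, mem_preimage]
  refine and_congr_left fun hy => ?_
  rw [piecewise_eq_of_mem _ _ _ hy]

theorem aemeasurable_volDensity (g : Metric n M) (c : M) :
    AEMeasurable (fun y => ENNReal.ofReal (volDensity g c y))
      (volume.restrict (extChartAt (𝓡 n) c).target) :=
  ((contDiffOn_volDensity g c).continuousOn.aemeasurable
    (isOpen_extChartAt_target c).measurableSet).ennreal_ofReal

theorem aemeasurable_extChartAt_symm (g : Metric n M) (c : M) :
    AEMeasurable (extChartAt (𝓡 n) c).symm
      ((volume.restrict (extChartAt (𝓡 n) c).target).withDensity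
        (fun y => ENNReal.ofReal (volDensity g c y))) :=
  ((continuousOn_extChartAt_symm c).aemeasurable
    (isOpen_extChartAt_target c).measurableSet).mono_ac (withDensity_absolutelyContinuous _ _)

theorem localVolume_apply (g : Metric n M) (c : M) {A : Set M} (hA : MeasurableSet A) :
    localVolume g c A =
      ∫⁻ y in (extChartAt (𝓡 n) c).symm ⁻¹' A ∩ (extChartAt (𝓡 n) c).target,
        ENNReal.ofReal (volDensity g c y) := by
  rw [localVolume, Measure.map_apply_of_aemeasurable (aemeasurable_extChartAt_symm g c) hA,
    withDensity_apply', Measure.restrict_restrict' (isOpen_extChartAt_target c).measurableSet]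

theorem localVolume_compl_source (g : Metric n M) (c : M) :
    localVolume g c (extChartAt (𝓡 n) c).sourceᶜ = 0 := by
  rw [localVolume_apply g c (isOpen_extChartAt_source c).measurableSet.compl]
  convert setLIntegral_empty _
  ext y
  simp only [mem_inter_iff, mem_preimage, mem_compl_iff, mem_empty_iff_false, iff_false, not_and]
  exact fun h hy => h ((extChartAt (𝓡 n) c).map_target hy)

/-- The transition map carries one coordinate image of `A` injectively onto the other, and the
Jacobian in the change of variables formula is the factor by which the densities differ. -/
theorem localVolume_eq_of_subset (g : Metric n M) {c c' : M} {A : Set M} (hA : MeasurableSet A)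
    (hc : A ⊆ (extChartAt (𝓡 n) c).source) (hc' : A ⊆ (extChartAt (𝓡 n) c').source) :
    localVolume g c A = localVolume g c' A := by
  rw [localVolume_apply g c hA, localVolume_apply g c' hA]
  set B := (extChartAt (𝓡 n) c').symm ⁻¹' A ∩ (extChartAt (𝓡 n) c').target
  have hB : MeasurableSet B := measurableSet_chart_preimage c' hA
  have himage : (extChartAt (𝓡 n) c).symm ⁻¹' A ∩ (extChartAt (𝓡 n) c).target =
      (fun z => extChartAt (𝓡 n) c ((extChartAt (𝓡 n) c').symm z)) '' B := by
    ext z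
    constructor
    · rintro ⟨hz, hzt⟩
      refine ⟨extChartAt (𝓡 n) c' ((extChartAt (𝓡 n) c).symm z), ⟨?_, ?_⟩, ?_⟩
      · simpa only [mem_preimage, (extChartAt (𝓡 n) c').left_inv (hc' hz)] using hz
      · exact (extChartAt (𝓡 n) c').map_source (hc' hz)
      · simp only [(extChartAt (𝓡 n) c').left_inv (hc' hz), (extChartAt (𝓡 n) c).right_inv hzt]
    · rintro ⟨y, ⟨hy, hyt⟩, rfl⟩
      refine ⟨?_, (extChartAt (𝓡 n) c).map_source (hc hy)⟩
      simpa only [mem_preimage, (extChartAt (𝓡 n) c).left_inv (hc hy)] using hy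
  rw [himage, lintegral_image_eq_lintegral_abs_det_fderiv_mul volume hB
    (fun y hy => (hasFDerivAt_coordChange hy.2 (hc hy.1)).hasFDerivWithinAt)]
  · refine setLIntegral_congr_fun hB fun y hy => ?_
    rw [volDensity_coordChange g (hc hy.1), ENNReal.ofReal_mul (abs_nonneg _)]
  · intro y hy z hz hyz
    have h1 := (extChartAt (𝓡 n) c).injOn (hc hy.1) (hc hz.1) hyz
    exact (extChartAt (𝓡 n) c').symm.injOn hy.2 hz.2 h1

/-- On the domain S of the chart at `c` every `localVolume g c'` is at most `localVolume g c`, by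
agreement on overlaps. So `localVolume g c` plus the volume restricted to the complement of S
dominates the whole family, hence its supremum; restricting to S gives the nontrivial inequality. -/
theorem riemannianVolume_restrict_source (g : Metric n M) (c : M) :
    (riemannianVolume g).restrict (extChartAt (𝓡 n) c).source = localVolume g c := by
  set S := (extChartAt (𝓡 n) c).source
  have hS : MeasurableSet S := (isOpen_extChartAt_source c).measurableSet
  have hcS : (localVolume g c).restrict S = localVolume g c :=
    Measure.restrict_eq_self_of_ae_mem (localVolume_compl_source g c)
  refine le_antisymm ?_ ?_
  · have hle : riemannianVolume g ≤ localVolume g c + (riemannianVolume g).restrict Sᶜ := by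
      refine iSup_le fun c' => ?_
      rw [← Measure.restrict_add_restrict_compl (μ := localVolume g c') hS]
      refine add_le_add ?_ (Measure.restrict_mono_measure (le_iSup (localVolume g) c') _)
      refine Measure.le_iff.2 fun A hA => ?_
      rw [Measure.restrict_apply hA]
      have hS' : MeasurableSet (extChartAt (𝓡 n) c').source :=
        (isOpen_extChartAt_source c').measurableSet
      have h1 : localVolume g c' (A ∩ S) =
          localVolume g c' (A ∩ S ∩ (extChartAt (𝓡 n) c').source) := by
        rw [measure_inter_conull (localVolume_compl_source g c')]
      rw [h1, localVolume_eq_of_subset g ((hA.inter hS).inter hS') (c := c') (c' := c)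
        inter_subset_right (inter_subset_left.trans inter_subset_right)]
      exact measure_mono (inter_subset_left.trans inter_subset_left)
    calc (riemannianVolume g).restrict S
        ≤ (localVolume g c + (riemannianVolume g).restrict Sᶜ).restrict S :=
          Measure.restrict_mono_measure hle _
      _ = localVolume g c := by
          rw [Measure.restrict_add, hcS, Measure.restrict_restrict hS, inter_compl_self,
            Measure.restrict_empty, add_zero]
  · rw [← hcS]
    exact Measure.restrict_mono_measure (le_iSup (localVolume g) c) _

/-- Integration over a chart domain. -/
theorem integral_riemannianVolume_of_support (g : Metric n M) (c : M) {G : M → ℝ}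
    (hG : Continuous G) (hGc : ∀ x ∉ (extChartAt (𝓡 n) c).source, G x = 0) :
    ∫ x, G x ∂(riemannianVolume g) =
      ∫ y in (extChartAt (𝓡 n) c).target, volDensity g c y * G ((extChartAt (𝓡 n) c).symm y) := by
  rw [← setIntegral_eq_integral_of_forall_compl_eq_zero hGc, riemannianVolume_restrict_source,
    localVolume, integral_map (aemeasurable_extChartAt_symm g c) hG.aestronglyMeasurable,
    integral_withDensity_eq_integral_toReal_smul₀ (aemeasurable_volDensity g c) (by simp)]
  refine integral_congr_ae (ae_of_all _ fun y => ?_)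
  simp only [smul_eq_mul]
  rw [ENNReal.toReal_ofReal (show 0 ≤ volDensity g c y from Real.sqrt_nonneg _)]

theorem isLocallyFiniteMeasure_riemannianVolume (g : Metric n M) :
    IsLocallyFiniteMeasure (riemannianVolume g) := by
  refine ⟨fun x => ?_⟩
  obtain ⟨K, hK, hKT, hKc⟩ : ∃ K ∈ 𝓝 (extChartAt (𝓡 n) x x),
      K ⊆ (extChartAt (𝓡 n) x).target ∧ IsCompact K :=
    local_compact_nhds ((isOpen_extChartAt_target (I := 𝓡 n) x).mem_nhds
      (mem_extChartAt_target x))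
  set A := (extChartAt (𝓡 n) x).source ∩ extChartAt (𝓡 n) x ⁻¹' (interior K)
  have hAo : IsOpen A := (continuousOn_extChartAt x).isOpen_inter_preimage
    (isOpen_extChartAt_source x) isOpen_interior
  have hxA : x ∈ A := ⟨mem_extChartAt_source x, mem_interior_iff_mem_nhds.2 hK⟩
  refine ⟨A, hAo.mem_nhds hxA, ?_⟩
  have h1 : riemannianVolume g A = localVolume g x A := by
    rw [← riemannianVolume_restrict_source, Measure.restrict_apply hAo.measurableSet,
      inter_eq_left.2 inter_subset_left]
  rw [h1, localVolume_apply g x hAo.measurableSet]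
  calc _ ≤ ∫⁻ y in K, ENNReal.ofReal (volDensity g x y) := by
        refine lintegral_mono_set ?_
        rintro y ⟨⟨_, hy⟩, hyT⟩
        rw [mem_preimage, (extChartAt (𝓡 n) x).right_inv hyT] at hy
        exact interior_subset hy
    _ < ⊤ := by
        have := ((contDiffOn_volDensity g x).continuousOn.mono hKT).integrableOn_compact hKc
          (μ := volume)
        exact this.setLIntegral_lt_top

theorem riemannianVolume_pos_of_isOpen (g : Metric n M) {A : Set M} (hA : IsOpen A) {x : M}
    (hx : x ∈ A) : riemannianVolume g A ≠ 0 := by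
  have hle : localVolume g x A ≤ riemannianVolume g A := (le_iSup (localVolume g) x) A
  refine fun h0 => ?_
  have h1 := le_antisymm (hle.trans h0.le) zero_le
  set B := (extChartAt (𝓡 n) x).symm ⁻¹' A ∩ (extChartAt (𝓡 n) x).target
  have hB : IsOpen B := by
    have := (continuousOn_extChartAt_symm x).isOpen_inter_preimage
      (isOpen_extChartAt_target (I := 𝓡 n) x) hA
    rwa [inter_comm] at this
  have hBx : extChartAt (𝓡 n) x x ∈ B :=
    ⟨by simpa using hx, mem_extChartAt_target x⟩
  rw [localVolume_apply g x hA.measurableSet,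
    lintegral_eq_zero_iff' ((aemeasurable_volDensity g x).mono_measure
      (Measure.restrict_mono inter_subset_right le_rfl)), ae_restrict_eq hB.measurableSet] at h1
  have h2 : ∀ᵐ y, y ∉ B := by
    rw [EventuallyEq, eventually_inf_principal] at h1
    filter_upwards [h1] with y hy hyB
    have := hy hyB
    simp only [Pi.zero_apply, ENNReal.ofReal_eq_zero] at this
    exact absurd this (not_le.2 (volDensity_pos g hyB.2))
  have h3 : volume B = 0 := by
    rw [← ae_iff.1 h2]; congr 1; ext; simp
  exact (hB.measure_pos volume ⟨_, hBx⟩).ne' h3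

/-- Compactness leaves finitely many charts to check, and in each of them the volume has a density
with respect to Lebesgue measure. -/
theorem riemannianVolume_null [CompactSpace M] (g : Metric n M) {N : Set M} (hN : MeasurableSet N)
    (h : ∀ c : M, volume ((extChartAt (𝓡 n) c).symm ⁻¹' N ∩ (extChartAt (𝓡 n) c).target) = 0) :
    riemannianVolume g N = 0 := by
  obtain ⟨t, ht⟩ := isCompact_univ.elim_finite_subcover
    (fun c : M => (extChartAt (𝓡 n) c).source) (fun c => isOpen_extChartAt_source c)
    (fun x _ => mem_iUnion.2 ⟨x, mem_extChartAt_source x⟩)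
  have h1 : N ⊆ ⋃ c ∈ t, N ∩ (extChartAt (𝓡 n) c).source := fun x hx => by
    have := ht (mem_univ x)
    simp only [mem_iUnion, exists_prop] at this ⊢
    obtain ⟨c, hc, hxc⟩ := this
    exact ⟨c, hc, hx, hxc⟩
  refine measure_mono_null h1 ((measure_biUnion_null_iff t.countable_toSet).2 fun c _ => ?_)
  rw [← Measure.restrict_apply hN, riemannianVolume_restrict_source, localVolume_apply g c hN]
  exact setLIntegral_measure_zero _ _ (h c)

/-! ### The weighted volume -/

theorem measurable_weight {f : M → ℝ} (hf : Continuous f) :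
    Measurable (fun x => ENNReal.ofReal (Real.exp (-f x))) :=
  ((Real.continuous_exp.comp hf.neg).measurable).ennreal_ofReal

theorem integral_weightedVolume (g : Metric n M) {f : M → ℝ} (hf : Continuous f) (G : M → ℝ) :
    ∫ x, G x ∂(weightedVolume g f) = ∫ x, Real.exp (-f x) * G x ∂(riemannianVolume g) := by
  rw [weightedVolume, integral_withDensity_eq_integral_toReal_smul (measurable_weight hf)
    (by simp)]
  refine integral_congr_ae (ae_of_all _ fun y => ?_)
  simp only [smul_eq_mul]
  rw [ENNReal.toReal_ofReal (Real.exp_nonneg _)]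

theorem isFiniteMeasure_weightedVolume [CompactSpace M] (g : Metric n M) {f : M → ℝ}
    (hf : Continuous f) : IsFiniteMeasure (weightedVolume g f) := by
  have := isLocallyFiniteMeasure_riemannianVolume g
  obtain ⟨C, hC⟩ := isCompact_univ.exists_bound_of_continuousOn
    (Real.continuous_exp.comp hf.neg).continuousOn
  refine isFiniteMeasure_withDensity (ne_of_lt ?_)
  calc ∫⁻ x, ENNReal.ofReal (Real.exp (-f x)) ∂(riemannianVolume g)
      ≤ ∫⁻ _, ENNReal.ofReal C ∂(riemannianVolume g) :=
        lintegral_mono fun x => ENNReal.ofReal_le_ofReal ((le_abs_self _).trans (hC x (mem_univ _)))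
    _ < ⊤ := by
        rw [lintegral_const]
        exact ENNReal.mul_lt_top ENNReal.ofReal_lt_top (measure_lt_top _ _)

theorem isOpenPosMeasure_weightedVolume (g : Metric n M) {f : M → ℝ} (hf : Continuous f) :
    (weightedVolume g f).IsOpenPosMeasure := by
  refine ⟨fun U hU ⟨x, hx⟩ h0 => riemannianVolume_pos_of_isOpen g hU hx ?_⟩
  refine withDensity_absolutelyContinuous' (measurable_weight hf).aemeasurable ?_ h0
  exact ae_of_all _ fun x => by simp [Real.exp_pos]

end Volume

end WeightedPHeat

namespace WeightedPHeat

open Filter Topology Bundle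
/-! ### Integration by parts in a vector space -/

section VectorSpace

variable {V : Type*} [NormedAddCommGroup V] [NormedSpace ℝ V] [FiniteDimensional ℝ V]
  [MeasurableSpace V] [BorelSpace V] {ν : Measure V} [ν.IsAddHaarMeasure]

theorem continuous_of_continuousOn_of_eq_zero {X Y : Type*} [TopologicalSpace X]
    [TopologicalSpace Y] [Zero Y] {U K : Set X} (hU : IsOpen U) (hK : IsClosed K) (hKU : K ⊆ U)
    {F : X → Y} (hF : ContinuousOn F U) (h0 : ∀ x ∉ K, F x = 0) : Continuous F :=
  hF.continuous_of_tsupport_subset hU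
    ((closure_minimal (fun x (hx : x ∈ Function.support F) => by_contra fun h => hx (h0 x h)) hK).trans hKU)

theorem integrable_of_continuousOn_of_eq_zero {U K : Set V} (hU : IsOpen U) (hK : IsCompact K)
    (hKU : K ⊆ U) {F : V → ℝ} (hF : ContinuousOn F U) (h0 : ∀ x ∉ K, F x = 0) :
    Integrable F ν :=
  (continuous_of_continuousOn_of_eq_zero hU hK.isClosed hKU hF h0).integrable_of_hasCompactSupport
    (HasCompactSupport.intro hK h0)

theorem fderiv_eq_zero_of_eq_zero {K : Set V} (hK : IsClosed K) {φ : V → ℝ}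
    (h0 : ∀ x ∉ K, φ x = 0) {x : V} (hx : x ∉ K) : fderiv ℝ φ x = 0 := by
  have : φ =ᶠ[𝓝 x] fun _ => 0 := by
    filter_upwards [hK.isOpen_compl.mem_nhds hx] with z hz using h0 z hz
  rw [this.fderiv_eq, fderiv_fun_const]
  rfl

/-- `Y` is controlled only on `U`, as the components of a field in a chart are. This suffices
because every product vanishes off `K`, and differentiability of `Y` is needed only on the support
of `φ`. -/
theorem integral_mul_fderiv_eq_neg_of_isCompact {U K : Set V} (hU : IsOpen U) (hK : IsCompact K)
    (hKU : K ⊆ U) {φ Y : V → ℝ} (hφ : ContDiffOn ℝ 1 φ U) (h0 : ∀ x ∉ K, φ x = 0)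
    (hY : ContDiffOn ℝ 1 Y U) (v : V) :
    Integrable (fun x => φ x * fderiv ℝ Y x v) ν ∧ Integrable (fun x => fderiv ℝ φ x v * Y x) ν ∧
    ∫ x, φ x * fderiv ℝ Y x v ∂ν = -∫ x, fderiv ℝ φ x v * Y x ∂ν := by
  have hd0 : ∀ x ∉ K, fderiv ℝ φ x = 0 := fun x hx =>
    fderiv_eq_zero_of_eq_zero hK.isClosed h0 hx
  have i1 : Integrable (fun x => φ x * fderiv ℝ Y x v) ν :=
    integrable_of_continuousOn_of_eq_zero hU hK hKU
      (hφ.continuousOn.mul ((hY.continuousOn_fderiv_of_isOpen hU le_rfl).clm_apply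
        continuousOn_const)) (fun x hx => by simp [h0 x hx])
  have i2 : Integrable (fun x => fderiv ℝ φ x v * Y x) ν :=
    integrable_of_continuousOn_of_eq_zero hU hK hKU
      (((hφ.continuousOn_fderiv_of_isOpen hU le_rfl).clm_apply
        continuousOn_const).mul hY.continuousOn) (fun x hx => by simp [hd0 x hx])
  have i3 : Integrable (fun x => φ x * Y x) ν :=
    integrable_of_continuousOn_of_eq_zero hU hK hKU (hφ.continuousOn.mul hY.continuousOn)
      (fun x hx => by simp [h0 x hx])
  refine ⟨i1, i2, integral_mul_fderiv_eq_neg_fderiv_mul_of_integrable i2 i1 i3 ?_ ?_⟩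
  · intro x _
    by_cases hx : x ∈ K
    · exact ((hφ.contDiffAt (hU.mem_nhds (hKU hx))).differentiableAt (by simp))
    · have : φ =ᶠ[𝓝 x] fun _ => 0 := by
        filter_upwards [hK.isClosed.isOpen_compl.mem_nhds hx] with z hz using h0 z hz
      exact this.differentiableAt_iff.2 (differentiableAt_const _)
  · intro x hx
    have : x ∈ K := closure_minimal
      (fun x (hx : x ∈ Function.support φ) => by_contra fun h => hx (h0 x h)) hK.isClosed hx
    exact ((hY.contDiffAt (hU.mem_nhds (hKU this))).differentiableAt (by simp))

end VectorSpace

variable {n m : ℕ} {M : Type*} [TopologicalSpace M]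
  [ChartedSpace (EuclideanSpace ℝ (Fin n)) M] [IsManifold (𝓡 n) ∞ M]

local notation "𝔼" => EuclideanSpace ℝ (Fin n)

/-- The divergence theorem for compactly supported fields in coordinate space. -/
theorem integral_mul_div_eq_neg {U K : Set 𝔼} (hU : IsOpen U) (hK : IsCompact K)
    (hKU : K ⊆ U) {φ : 𝔼 → ℝ} {Y : 𝔼 → 𝔼} (hφ : ContDiffOn ℝ 1 φ U) (h0 : ∀ x ∉ K, φ x = 0)
    (hY : ∀ i, ContDiffOn ℝ 1 (fun y => Y y i) U) :
    ∫ x, φ x * ∑ i, fderiv ℝ (fun y => Y y i) x (EuclideanSpace.single i 1) =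
      -∫ x, fderiv ℝ φ x (Y x) := by
  have h := fun i => integral_mul_fderiv_eq_neg_of_isCompact (ν := volume) hU hK hKU hφ h0 (hY i)
    (EuclideanSpace.single i (1 : ℝ))
  have hsum : ∀ x, fderiv ℝ φ x (Y x) =
      ∑ i, fderiv ℝ φ x (EuclideanSpace.single i (1 : ℝ)) * Y x i := fun x => by
    have hv : Y x = ∑ i, Y x i • EuclideanSpace.single i (1 : ℝ) := by
      ext k; simp [Finset.sum_apply, Pi.single_apply]
    conv_lhs => rw [hv]
    simp only [map_sum, map_smul, smul_eq_mul, mul_comm]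
  simp only [hsum, Finset.mul_sum]
  rw [integral_finsetSum _ fun i _ => (h i).1, integral_finsetSum _ fun i _ => (h i).2.1,
    ← Finset.sum_neg_distrib]
  exact Finset.sum_congr rfl fun i _ => (h i).2.2

/-! ### Functions on the manifold in a chart -/

theorem continuous_of_continuousOn_charts {Y : Type*} [TopologicalSpace Y] {F : M → Y}
    (h : ∀ c : M, ContinuousOn (fun y => F ((extChartAt (𝓡 n) c).symm y))
      (extChartAt (𝓡 n) c).target) : Continuous F := by
  refine continuous_iff_continuousAt.2 fun x => ?_
  have h1 := (h x).continuousAt ((isOpen_extChartAt_target (I := 𝓡 n) x).mem_nhds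
    (mem_extChartAt_target x))
  have h2 := ContinuousAt.comp (f := extChartAt (𝓡 n) x) h1 (continuousAt_extChartAt x)
  refine h2.congr ?_
  filter_upwards [extChartAt_source_mem_nhds (I := 𝓡 n) x] with z hz
  simp only [Function.comp, (extChartAt (𝓡 n) x).left_inv hz]

theorem contDiffOn_comp_symm {W : Type*} [NormedAddCommGroup W] [NormedSpace ℝ W]
    {k : WithTop ℕ∞} (hk : k ≤ ∞) {φ : M → W} (hφ : ContMDiff (𝓡 n) 𝓘(ℝ, W) k φ) (c : M) :
    ContDiffOn ℝ k (fun y => φ ((extChartAt (𝓡 n) c).symm y)) (extChartAt (𝓡 n) c).target := by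
  rw [← contMDiffOn_iff_contDiffOn]
  exact hφ.comp_contMDiffOn ((contMDiffOn_extChartAt_symm' c).of_le hk)

/-- The derivative `dφ(X)` of a function along a vector field. -/
noncomputable def dirDeriv (X : (x : M) → TangentSpace (𝓡 n) x) (φ : M → ℝ) (x : M) : ℝ :=
  mfderiv (𝓡 n) 𝓘(ℝ, ℝ) φ x (X x)

theorem mfderiv_symm_eq {φ : M → ℝ} {c : M} {y : 𝔼} (hy : y ∈ (extChartAt (𝓡 n) c).target)
    (hφ : MDifferentiableAt (𝓡 n) 𝓘(ℝ, ℝ) φ ((extChartAt (𝓡 n) c).symm y))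
    (v : TangentSpace (𝓡 n) ((extChartAt (𝓡 n) c).symm y)) :
    (mfderiv (𝓡 n) 𝓘(ℝ, ℝ) φ ((extChartAt (𝓡 n) c).symm y) v : ℝ) =
      fderiv ℝ (fun z => φ ((extChartAt (𝓡 n) c).symm z)) y
        (coframeMap c ((extChartAt (𝓡 n) c).symm y) v) := by
  have h1 : HasMFDerivAt 𝓘(ℝ, 𝔼) (𝓡 n) (extChartAt (𝓡 n) c).symm y (frameMap c y) :=
    ((contMDiffAt_extChartAt_symm hy).mdifferentiableAt (by simp)).hasMFDerivAt
  have h2 : HasFDerivAt (fun z => φ ((extChartAt (𝓡 n) c).symm z))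
      ((show TangentSpace (𝓡 n) ((extChartAt (𝓡 n) c).symm y) →L[ℝ] ℝ from
        mfderiv (𝓡 n) 𝓘(ℝ, ℝ) φ ((extChartAt (𝓡 n) c).symm y)).comp (frameMap c y)) y :=
    hasMFDerivAt_iff_hasFDerivAt.1 (hφ.hasMFDerivAt.comp y h1)
  rw [h2.fderiv]
  exact congrArg (mfderiv (𝓡 n) 𝓘(ℝ, ℝ) φ ((extChartAt (𝓡 n) c).symm y))
    (frameMap_coframeMap hy v).symm

theorem dirDeriv_symm_eq (X : (x : M) → TangentSpace (𝓡 n) x) {φ : M → ℝ} {c : M} {y : 𝔼}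
    (hy : y ∈ (extChartAt (𝓡 n) c).target)
    (hφ : MDifferentiableAt (𝓡 n) 𝓘(ℝ, ℝ) φ ((extChartAt (𝓡 n) c).symm y)) :
    dirDeriv X φ ((extChartAt (𝓡 n) c).symm y) =
      fderiv ℝ (fun z => φ ((extChartAt (𝓡 n) c).symm z)) y (coordField c X y) :=
  mfderiv_symm_eq hy hφ _

/-- `X` is a `C^1` vector field. -/
def IsC1Field (X : (x : M) → TangentSpace (𝓡 n) x) : Prop :=
  ContMDiff (𝓡 n) (𝓡 n).tangent 1 (fun x => (⟨x, X x⟩ : TangentBundle (𝓡 n) M))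

theorem IsC1Field.contDiffOn {X : (x : M) → TangentSpace (𝓡 n) x} (hX : IsC1Field X) (c : M) :
    ContDiffOn ℝ 1 (coordField c X) (extChartAt (𝓡 n) c).target :=
  (contMDiff_field_iff (by simp) X).1 hX c

theorem IsC1Field.contDiffOn_apply {X : (x : M) → TangentSpace (𝓡 n) x} (hX : IsC1Field X)
    (c : M) (i : Fin n) :
    ContDiffOn ℝ 1 (fun y => coordField c X y i) (extChartAt (𝓡 n) c).target :=
  contDiffOn_euclidean.1 (hX.contDiffOn c) i

theorem continuous_dirDeriv {X : (x : M) → TangentSpace (𝓡 n) x} (hX : IsC1Field X) {φ : M → ℝ}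
    (hφ : ContMDiff (𝓡 n) 𝓘(ℝ, ℝ) 1 φ) : Continuous (dirDeriv X φ) := by
  refine continuous_of_continuousOn_charts (n := n) fun c => ?_
  refine ContinuousOn.congr (((contDiffOn_comp_symm (by simp) hφ c).continuousOn_fderiv_of_isOpen
    (isOpen_extChartAt_target c) le_rfl).clm_apply (hX.contDiffOn c).continuousOn) fun y hy => ?_
  exact dirDeriv_symm_eq X hy (hφ.mdifferentiable (by simp) _)

theorem dirDeriv_eq_zero (X : (x : M) → TangentSpace (𝓡 n) x) {φ : M → ℝ} {x : M}
    (hx : x ∉ tsupport φ) : dirDeriv X φ x = 0 := by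
  have h1 : φ =ᶠ[𝓝 x] fun _ => 0 := by
    rw [notMem_tsupport_iff_eventuallyEq] at hx
    exact hx
  rw [dirDeriv, h1.mfderiv_eq, mfderiv_const]
  rfl

/-! ### The divergence in a chart -/

/-- The divergence of `X` computed in the chart at `c`. -/
noncomputable def chartDiv (g : Metric n M) (c : M) (X : (x : M) → TangentSpace (𝓡 n) x)
    (y : 𝔼) : ℝ :=
  (volDensity g c y)⁻¹ * ∑ i, fderiv ℝ (fun z => volDensity g c z * coordField c X z i) y
    (EuclideanSpace.single i (1 : ℝ))

theorem contDiffOn_volDensity_mul (g : Metric n M) {X : (x : M) → TangentSpace (𝓡 n) x}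
    (hX : IsC1Field X) (c : M) (i : Fin n) :
    ContDiffOn ℝ 1 (fun z => volDensity g c z * coordField c X z i)
      (extChartAt (𝓡 n) c).target :=
  ((contDiffOn_volDensity g c).of_le (by simp)).mul (hX.contDiffOn_apply c i)

theorem continuousOn_chartDiv (g : Metric n M) {X : (x : M) → TangentSpace (𝓡 n) x}
    (hX : IsC1Field X) (c : M) :
    ContinuousOn (chartDiv g c X) (extChartAt (𝓡 n) c).target := by
  refine ContinuousOn.mul ((contDiffOn_volDensity g c).continuousOn.inv₀
    fun y hy => (volDensity_pos g hy).ne') ?_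
  refine continuousOn_finsetSum _ fun i _ => ?_
  exact ((contDiffOn_volDensity_mul g hX c i).continuousOn_fderiv_of_isOpen
    (isOpen_extChartAt_target c) le_rfl).clm_apply continuousOn_const

/-! ### The divergence theorem on the closed manifold -/

section Divergence

variable [CompactSpace M] [T2Space M] [MeasurableSpace M] [BorelSpace M]

theorem continuous_mul_of_tsupport {φ D : M → ℝ} {S : Set M} (hS : IsOpen S)
    (hφ : Continuous φ) (hφS : tsupport φ ⊆ S) (hD : ContinuousOn D S) :
    Continuous (fun x => φ x * D x) :=
  continuous_of_continuousOn_of_eq_zero hS (isClosed_tsupport φ) hφS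
    (hφ.continuousOn.mul hD) fun x hx => by simp [image_eq_zero_of_notMem_tsupport hx]

/-- The divergence theorem for a test function supported in a chart domain. -/
theorem integral_mul_chartDiv (g : Metric n M) {X : (x : M) → TangentSpace (𝓡 n) x}
    (hX : IsC1Field X) (c : M) {φ : M → ℝ} (hφ : ContMDiff (𝓡 n) 𝓘(ℝ, ℝ) 1 φ)
    (hφc : tsupport φ ⊆ (extChartAt (𝓡 n) c).source) :
    ∫ x, φ x * chartDiv g c X (extChartAt (𝓡 n) c x) ∂(riemannianVolume g) =
      -∫ x, dirDeriv X φ x ∂(riemannianVolume g) := by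
  set S := (extChartAt (𝓡 n) c).source
  set T := (extChartAt (𝓡 n) c).target
  have hT : IsOpen T := isOpen_extChartAt_target c
  have hcont : Continuous fun x => φ x * chartDiv g c X (extChartAt (𝓡 n) c x) :=
    continuous_mul_of_tsupport (isOpen_extChartAt_source c) hφ.continuous hφc
      ((continuousOn_chartDiv g hX c).comp (continuousOn_extChartAt c)
        (extChartAt (𝓡 n) c).mapsTo)
  have hφ0 : ∀ x ∉ S, φ x = 0 := fun x hx =>
    image_eq_zero_of_notMem_tsupport fun h => hx (hφc h)
  rw [integral_riemannianVolume_of_support g c hcont fun x hx => by simp [hφ0 x hx],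
    integral_riemannianVolume_of_support g c (continuous_dirDeriv hX hφ) fun x hx =>
      dirDeriv_eq_zero X fun h => hx (hφc h)]
  set K := extChartAt (𝓡 n) c '' tsupport φ
  have hK : IsCompact K := (isClosed_tsupport φ).isCompact.image_of_continuousOn
    ((continuousOn_extChartAt c).mono hφc)
  have hKT : K ⊆ T := by
    rintro _ ⟨x, hx, rfl⟩
    exact (extChartAt (𝓡 n) c).map_source (hφc hx)
  set η : 𝔼 → ℝ := T.indicator fun y => φ ((extChartAt (𝓡 n) c).symm y)
  have hηeq : ∀ y ∈ T, η y = φ ((extChartAt (𝓡 n) c).symm y) := fun y hy => indicator_of_mem hy _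
  have hη : ContDiffOn ℝ 1 η T := (contDiffOn_comp_symm (by simp) hφ c).congr hηeq
  have hη0 : ∀ y ∉ K, η y = 0 := by
    intro y hy
    by_cases hyT : y ∈ T
    · rw [hηeq y hyT]
      refine image_eq_zero_of_notMem_tsupport fun h => hy ⟨_, h, ?_⟩
      exact (extChartAt (𝓡 n) c).right_inv hyT
    · exact indicator_of_notMem hyT _
  -- Apply the Euclidean statement to the field √(det g) X: the density of the volume cancels the
  -- prefactor (det g)^{-1/2} of the divergence on one side, and on the other it comes out of the
  -- linear map dη.
  have key := integral_mul_div_eq_neg hT hK hKT (Y := fun y => volDensity g c y • coordField c X y)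
    hη hη0 (fun i => contDiffOn_volDensity_mul g hX c i)
  rw [← setIntegral_eq_integral_of_forall_compl_eq_zero (s := T) (fun y hy => by
      rw [hη0 y fun h => hy (hKT h), zero_mul]),
    ← setIntegral_eq_integral_of_forall_compl_eq_zero (s := T) (f := fun x => fderiv ℝ η x _)
      (fun y hy => by
        rw [fderiv_eq_zero_of_eq_zero hK.isClosed hη0 fun h => hy (hKT h)]; rfl)] at key
  rw [setIntegral_congr_fun hT.measurableSet (g := fun y => volDensity g c y *
      dirDeriv X φ ((extChartAt (𝓡 n) c).symm y))
    (f := fun y => fderiv ℝ η y (volDensity g c y • coordField c X y))] at key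
  · rw [← key]
    refine setIntegral_congr_fun hT.measurableSet fun y hy => ?_
    simp only [hηeq y hy, (extChartAt (𝓡 n) c).right_inv hy, chartDiv]
    have := (volDensity_pos g hy).ne'
    simp only [PiLp.smul_apply, smul_eq_mul]
    field_simp
  · intro y hy
    have h1 : η =ᶠ[𝓝 y] fun z => φ ((extChartAt (𝓡 n) c).symm z) := by
      filter_upwards [hT.mem_nhds hy] with z hz using hηeq z hz
    simp only [h1.fderiv_eq, map_smul, smul_eq_mul]
    rw [dirDeriv_symm_eq X hy (hφ.mdifferentiable (by simp) _)]

/-- A test function in coordinate space, carried over to the manifold. -/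
theorem exists_pullback_test_function (c : M) {η : 𝔼 → ℝ} (hη : ContDiff ℝ ∞ η)
    (hηs : HasCompactSupport η) (hηT : tsupport η ⊆ (extChartAt (𝓡 n) c).target) :
    ∃ φ : M → ℝ, ContMDiff (𝓡 n) 𝓘(ℝ, ℝ) 1 φ ∧
      tsupport φ ⊆ (extChartAt (𝓡 n) c).symm '' tsupport η ∧
      ∀ y ∈ (extChartAt (𝓡 n) c).target, φ ((extChartAt (𝓡 n) c).symm y) = η y := by
  set S := (extChartAt (𝓡 n) c).source
  set K := (extChartAt (𝓡 n) c).symm '' tsupport η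
  have hK : IsClosed K := (hηs.isCompact.image_of_continuousOn
    ((continuousOn_extChartAt_symm c).mono hηT)).isClosed
  set φ : M → ℝ := S.indicator fun x => η (extChartAt (𝓡 n) c x)
  have hφ0 : ∀ x ∉ K, φ x = 0 := by
    intro x hx
    by_cases hxS : x ∈ S
    · rw [show φ x = η (extChartAt (𝓡 n) c x) from indicator_of_mem hxS _]
      refine image_eq_zero_of_notMem_tsupport fun h => hx ⟨_, h, ?_⟩
      exact (extChartAt (𝓡 n) c).left_inv hxS
    · exact indicator_of_notMem hxS _
  refine ⟨φ, fun x => ?_, closure_minimal (fun x hx => by_contra fun h => hx (hφ0 x h)) hK, ?_⟩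
  · by_cases hxK : x ∈ K
    · have hxS : x ∈ S := by
        obtain ⟨y, hy, rfl⟩ := hxK
        exact (extChartAt (𝓡 n) c).map_target (hηT hy)
      have h1 : ContMDiffAt (𝓡 n) 𝓘(ℝ, ℝ) 1 (fun x => η (extChartAt (𝓡 n) c x)) x :=
        (hη.contMDiff.of_le (by simp)).contMDiffAt.comp x
          (contMDiffAt_extChartAt' (by rwa [← extChartAt_source (𝓡 n)]))
      refine h1.congr_of_eventuallyEq ?_
      filter_upwards [(isOpen_extChartAt_source (I := 𝓡 n) c).mem_nhds hxS] with z hz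
        using indicator_of_mem hz _
    · refine (contMDiffAt_const (c := (0 : ℝ))).congr_of_eventuallyEq ?_
      filter_upwards [hK.isOpen_compl.mem_nhds hxK] with z hz using hφ0 z hz
  · intro y hy
    rw [show φ ((extChartAt (𝓡 n) c).symm y) = _ from
      indicator_of_mem ((extChartAt (𝓡 n) c).map_target hy) _, (extChartAt (𝓡 n) c).right_inv hy]

/-- The divergence does not depend on the chart in which it is computed. -/
theorem divergence_eq_chartDiv (g : Metric n M) {X : (x : M) → TangentSpace (𝓡 n) x}
    (hX : IsC1Field X) (c : M) {q : M} (hq : q ∈ (extChartAt (𝓡 n) c).source) :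
    divergence g X q = chartDiv g c X (extChartAt (𝓡 n) c q) := by
  set T := (extChartAt (𝓡 n) c).target
  set Sq := (extChartAt (𝓡 n) q).source
  set W := T ∩ (extChartAt (𝓡 n) c).symm ⁻¹' Sq
  have hW : IsOpen W := (continuousOn_extChartAt_symm c).isOpen_inter_preimage
    (isOpen_extChartAt_target c) (isOpen_extChartAt_source q)
  set F₁ : 𝔼 → ℝ := fun y => chartDiv g c X y
  set F₂ : 𝔼 → ℝ := fun y =>
    chartDiv g q X (extChartAt (𝓡 n) q ((extChartAt (𝓡 n) c).symm y))
  have hF₁ : ContinuousOn F₁ W := (continuousOn_chartDiv g hX c).mono inter_subset_left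
  have hF₂ : ContinuousOn F₂ W := by
    refine (continuousOn_chartDiv g hX q).comp ((continuousOn_extChartAt q).comp
      ((continuousOn_extChartAt_symm c).mono inter_subset_left) fun y hy => hy.2) fun y hy => ?_
    exact (extChartAt (𝓡 n) q).map_source hy.2
  have hσ : ContinuousOn (volDensity g c) W :=
    (contDiffOn_volDensity g c).continuousOn.mono inter_subset_left
  -- No transformation law is computed. Tested against any function supported in the overlap, both
  -- local divergences integrate to the same chart-free quantity -∫ dφ(X), so they agree almost
  -- everywhere there. Both are continuous, hence they agree everywhere on the overlap.
  have hae : ∀ᵐ y, y ∈ W → volDensity g c y * (F₁ y - F₂ y) = 0 := by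
    refine hW.ae_eq_zero_of_integral_contDiff_smul_eq_zero
      ((hσ.mul (hF₁.sub hF₂)).locallyIntegrableOn hW.measurableSet) ?_
    intro η hη hηs hηW
    obtain ⟨φ, hφ, hφs, hφη⟩ := exists_pullback_test_function c hη hηs
      (hηW.trans inter_subset_left)
    have hφc : tsupport φ ⊆ (extChartAt (𝓡 n) c).source := by
      refine hφs.trans ?_
      rintro _ ⟨y, hy, rfl⟩
      exact (extChartAt (𝓡 n) c).map_target (hηW hy).1
    have hφq : tsupport φ ⊆ Sq := by
      refine hφs.trans ?_
      rintro _ ⟨y, hy, rfl⟩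
      exact (hηW hy).2
    have e := (integral_mul_chartDiv g hX c hφ hφc).trans
      (integral_mul_chartDiv g hX q hφ hφq).symm
    have hc1 : Continuous fun x => φ x * chartDiv g c X (extChartAt (𝓡 n) c x) :=
      continuous_mul_of_tsupport (isOpen_extChartAt_source c) hφ.continuous hφc
        ((continuousOn_chartDiv g hX c).comp (continuousOn_extChartAt c)
          (extChartAt (𝓡 n) c).mapsTo)
    have hc2 : Continuous fun x => φ x * chartDiv g q X (extChartAt (𝓡 n) q x) :=
      continuous_mul_of_tsupport (isOpen_extChartAt_source q) hφ.continuous hφq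
        ((continuousOn_chartDiv g hX q).comp (continuousOn_extChartAt q)
          (extChartAt (𝓡 n) q).mapsTo)
    have hφ0 : ∀ x ∉ (extChartAt (𝓡 n) c).source, φ x = 0 := fun x hx =>
      image_eq_zero_of_notMem_tsupport fun h => hx (hφc h)
    rw [integral_riemannianVolume_of_support g c hc1 fun x hx => by simp [hφ0 x hx],
      integral_riemannianVolume_of_support g c hc2 fun x hx => by simp [hφ0 x hx]] at e
    have hη0 : ∀ y ∉ tsupport η, η y = 0 := fun y hy => image_eq_zero_of_notMem_tsupport hy
    have i1 : Integrable (fun y => η y * (volDensity g c y * F₁ y)) :=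
      integrable_of_continuousOn_of_eq_zero hW hηs.isCompact hηW
        (hη.continuous.continuousOn.mul (hσ.mul hF₁)) fun y hy => by simp [hη0 y hy]
    have i2 : Integrable (fun y => η y * (volDensity g c y * F₂ y)) :=
      integrable_of_continuousOn_of_eq_zero hW hηs.isCompact hηW
        (hη.continuous.continuousOn.mul (hσ.mul hF₂)) fun y hy => by simp [hη0 y hy]
    have hsplit : ∀ y, η y • (volDensity g c y * (F₁ y - F₂ y)) =
        η y * (volDensity g c y * F₁ y) - η y * (volDensity g c y * F₂ y) := fun y => by
      rw [smul_eq_mul]; ring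
    simp only [hsplit]
    rw [integral_sub i1 i2, sub_eq_zero]
    have hTη : ∀ y ∉ T, η y = 0 := fun y hy => hη0 y fun h => hy (hηW h).1
    rw [← setIntegral_eq_integral_of_forall_compl_eq_zero (s := T) fun y hy => by
        simp [hTη y hy],
      ← setIntegral_eq_integral_of_forall_compl_eq_zero (s := T)
        (f := fun y => η y * (volDensity g c y * F₂ y)) fun y hy => by simp [hTη y hy]]
    have hTm : MeasurableSet T := (isOpen_extChartAt_target c).measurableSet
    refine Eq.trans (setIntegral_congr_fun hTm fun y hy => ?_)
      (e.trans (setIntegral_congr_fun hTm fun y hy => ?_))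
    · simp only [hφη y hy, (extChartAt (𝓡 n) c).right_inv hy, F₁]; ring
    · simp only [hφη y hy, F₂]; ring
  have hEq : EqOn F₁ F₂ W := by
    refine Measure.eqOn_open_of_ae_eq (μ := volume) ?_ hW hF₁ hF₂
    rw [EventuallyEq, ae_restrict_iff' hW.measurableSet]
    filter_upwards [hae] with y hy hyW
    have := (mul_eq_zero.1 (hy hyW)).resolve_left (volDensity_pos g hyW.1).ne'
    linarith
  have hqW : extChartAt (𝓡 n) c q ∈ W := by
    refine ⟨(extChartAt (𝓡 n) c).map_source hq, ?_⟩
    rw [mem_preimage, (extChartAt (𝓡 n) c).left_inv hq]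
    exact mem_extChartAt_source q
  have := hEq hqW
  simp only [F₁, F₂, (extChartAt (𝓡 n) c).left_inv hq] at this
  rw [this]
  rfl

theorem continuous_divergence (g : Metric n M) {X : (x : M) → TangentSpace (𝓡 n) x}
    (hX : IsC1Field X) : Continuous (divergence g X) := by
  refine continuous_of_continuousOn_charts (n := n) fun c =>
    (continuousOn_chartDiv g hX c).congr fun y hy => ?_
  rw [divergence_eq_chartDiv g hX c ((extChartAt (𝓡 n) c).map_target hy),
    (extChartAt (𝓡 n) c).right_inv hy]

theorem integral_mul_divergence (g : Metric n M) {X : (x : M) → TangentSpace (𝓡 n) x}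
    (hX : IsC1Field X) {φ : M → ℝ} (hφ : ContMDiff (𝓡 n) 𝓘(ℝ, ℝ) 1 φ) :
    ∫ x, φ x * divergence g X x ∂(riemannianVolume g) =
      -∫ x, dirDeriv X φ x ∂(riemannianVolume g) := by
  have := isLocallyFiniteMeasure_riemannianVolume g
  have hint : ∀ F : M → ℝ, Continuous F → Integrable F (riemannianVolume g) := fun F hF =>
    hF.integrable_of_hasCompactSupport (HasCompactSupport.of_compactSpace F)
  obtain ⟨ρ, hρ⟩ := SmoothPartitionOfUnity.exists_isSubordinate_chartAt_source (𝓡 n) M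
  set t : Finset M := ρ.locallyFinite.finite_nonempty_of_compact.toFinset
  have hρ1 : ∀ i, ContMDiff (𝓡 n) 𝓘(ℝ, ℝ) 1 (fun x => ρ i x * φ x) := fun i =>
    ((ρ i).contMDiff.of_le (by simp)).mul hφ
  have hsum : ∀ x, ∑ i ∈ t, ρ i x = 1 := fun x => by
    rw [← ρ.sum_eq_one (mem_univ x), finsum_eq_sum_of_support_subset]
    intro i hi
    simp only [t, Finite.coe_toFinset, mem_ofPred_eq]
    exact ⟨x, hi⟩
  -- Induction over partial sums of the partition of unity uses only additivity of `dirDeriv` in the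
  -- function; each single term is supported in one chart domain.
  have hpart : ∀ s : Finset M, ContMDiff (𝓡 n) 𝓘(ℝ, ℝ) 1 (fun x => ∑ i ∈ s, ρ i x * φ x) ∧
      ∫ x, (∑ i ∈ s, ρ i x * φ x) * divergence g X x ∂(riemannianVolume g) =
        -∫ x, dirDeriv X (fun z => ∑ i ∈ s, ρ i z * φ z) x ∂(riemannianVolume g) := by
    classical
    intro s
    induction s using Finset.induction_on with
    | empty =>
      refine ⟨by simpa using contMDiff_const, ?_⟩
      simp only [Finset.sum_empty, zero_mul, integral_zero]
      have : ∀ x, dirDeriv X (fun _ : M => (0 : ℝ)) x = 0 := fun x =>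
        dirDeriv_eq_zero X (by simp [tsupport, Function.support])
      simp [this]
    | insert i s hi ih =>
      have hsplit : (fun x => ∑ j ∈ insert i s, ρ j x * φ x) =
          (fun x => ρ i x * φ x) + fun x => ∑ j ∈ s, ρ j x * φ x := by
        ext x; simp [Finset.sum_insert hi]
      refine ⟨by rw [hsplit]; exact (hρ1 i).add ih.1, ?_⟩
      have hd : ∀ x, dirDeriv X (fun x => ∑ j ∈ insert i s, ρ j x * φ x) x =
          dirDeriv X (fun x => ρ i x * φ x) x +
            dirDeriv X (fun x => ∑ j ∈ s, ρ j x * φ x) x := fun x => by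
        rw [hsplit, dirDeriv, mfderiv_add ((hρ1 i).mdifferentiable (by simp) x)
          (ih.1.mdifferentiable (by simp) x)]
        rfl
      have hloc : ∫ x, (ρ i x * φ x) * divergence g X x ∂(riemannianVolume g) =
          -∫ x, dirDeriv X (fun z => ρ i z * φ z) x ∂(riemannianVolume g) := by
        have hs : tsupport (fun x => ρ i x * φ x) ⊆ (extChartAt (𝓡 n) i).source := by
          rw [extChartAt_source]
          exact (closure_mono (Function.support_mul_subset_left _ _)).trans (hρ i)
        rw [← integral_mul_chartDiv g hX i (hρ1 i) hs]
        refine integral_congr_ae (ae_of_all _ fun x => ?_)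
        simp only
        by_cases hx : x ∈ (extChartAt (𝓡 n) i).source
        · rw [divergence_eq_chartDiv g hX i hx]
        · rw [show ρ i x * φ x = 0 from image_eq_zero_of_notMem_tsupport (f := fun x => ρ i x * φ x)
            fun h => hx (hs h), zero_mul, zero_mul]
      simp only [hd]
      simp only [Finset.sum_insert hi, add_mul]
      rw [integral_add, integral_add, hloc, ih.2]
      · ring
      · exact hint _ (continuous_dirDeriv hX (hρ1 i))
      · exact hint _ (continuous_dirDeriv hX ih.1)
      · exact hint _ ((hρ1 i).continuous.mul (continuous_divergence g hX))
      · exact hint _ (ih.1.continuous.mul (continuous_divergence g hX))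
  have hφt : (fun x => ∑ i ∈ t, ρ i x * φ x) = φ := by
    ext x; rw [← Finset.sum_mul, hsum, one_mul]
  have := (hpart t).2
  rw [hφt] at this
  rw [← this]
  refine integral_congr_ae (ae_of_all _ fun x => ?_)
  simp only
  rw [← Finset.sum_mul, hsum, one_mul]

/-! ### The weighted divergence -/

theorem IsC1Field.smul {X : (x : M) → TangentSpace (𝓡 n) x} (hX : IsC1Field X) {h : M → ℝ}
    (hh : ContMDiff (𝓡 n) 𝓘(ℝ, ℝ) 1 h) : IsC1Field (fun x => h x • X x) := by
  refine (contMDiff_field_iff (by simp) _).2 fun c => ?_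
  refine ((contDiffOn_comp_symm (by simp) hh c).smul (hX.contDiffOn c)).congr fun y _ => ?_
  simp only [coordField_eq, map_smul, Pi.smul_apply']

theorem contMDiff_exp_neg {f : M → ℝ} (hf : ContMDiff (𝓡 n) 𝓘(ℝ, ℝ) 1 f) :
    ContMDiff (𝓡 n) 𝓘(ℝ, ℝ) 1 (fun x => Real.exp (-f x)) :=
  Real.contDiff_exp.contMDiff.comp hf.neg

theorem continuous_weightedDiv (g : Metric n M) {f : M → ℝ} (hf : ContMDiff (𝓡 n) 𝓘(ℝ, ℝ) 1 f)
    {X : (x : M) → TangentSpace (𝓡 n) x} (hX : IsC1Field X) :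
    Continuous (weightedDiv g f X) :=
  (Real.continuous_exp.comp hf.continuous).mul
    (continuous_divergence g (hX.smul (contMDiff_exp_neg hf)))

/-- The divergence theorem for the weighted volume. -/
theorem integral_mul_weightedDiv (g : Metric n M) {f : M → ℝ}
    (hf : ContMDiff (𝓡 n) 𝓘(ℝ, ℝ) 1 f) {X : (x : M) → TangentSpace (𝓡 n) x} (hX : IsC1Field X)
    {φ : M → ℝ} (hφ : ContMDiff (𝓡 n) 𝓘(ℝ, ℝ) 1 φ) :
    ∫ x, φ x * weightedDiv g f X x ∂(weightedVolume g f) =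
      -∫ x, dirDeriv X φ x ∂(weightedVolume g f) := by
  rw [integral_weightedVolume g hf.continuous, integral_weightedVolume g hf.continuous]
  have := integral_mul_divergence g (hX.smul (contMDiff_exp_neg hf)) hφ
  refine Eq.trans (integral_congr_ae (ae_of_all _ fun x => ?_))
    (this.trans (congrArg _ (integral_congr_ae (ae_of_all _ fun x => ?_))))
  · have h1 : Real.exp (-f x) * Real.exp (f x) = 1 := by rw [← Real.exp_add]; simp
    simp only [weightedDiv]
    linear_combination φ x * divergence g (fun x => Real.exp (-f x) • X x) x * h1
  · exact map_smul (mfderiv (𝓡 n) 𝓘(ℝ, ℝ) φ x) (Real.exp (-f x)) (X x)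

end Divergence

end WeightedPHeat

namespace WeightedPHeat

open Filter Topology Bundle
/-! ### The derivative vanishes almost everywhere on a level set -/

/-- Near a zero with nonzero derivative there is no other zero, so each point of this set is
isolated in it from the right. A set of reals has only countably many such points. -/
theorem countable_setOf_zero_deriv_ne_zero (h : ℝ → ℝ) :
    {x | h x = 0 ∧ ∃ d ≠ 0, HasDerivAt h d x}.Countable := by
  set Z := {x | h x = 0 ∧ ∃ d ≠ 0, HasDerivAt h d x}
  refine (countable_setOfPred_isolated_right_within (s := Z)).mono fun x hx => ?_
  refine ⟨hx, ?_⟩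
  obtain ⟨_, d, hd, hder⟩ := hx
  have h1 := hder.eventually_ne (c := 0) hd
  rw [← empty_mem_iff_bot]
  have h2 : ∀ᶠ z in 𝓝[Z ∩ Ioi x] x, h z ≠ 0 :=
    h1.filter_mono (nhdsWithin_mono x fun z hz => ne_of_gt hz.2)
  filter_upwards [h2, self_mem_nhdsWithin] with z hz hz'
  exact hz hz'.1.1

section VectorSpace

variable {V : Type*} [NormedAddCommGroup V] [NormedSpace ℝ V] [FiniteDimensional ℝ V]
  [MeasurableSpace V] [BorelSpace V] {ν : Measure V} [ν.IsAddHaarMeasure]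

/-- By Fubini along the lines parallel to `v`: on each line the exceptional parameters are zeros of
a one-variable function with nonzero derivative, hence countable and so null. -/
theorem ae_fderiv_eq_zero_of_eq_zero {U : Set V} (hU : IsOpen U) {h : V → ℝ}
    (hh : ContDiffOn ℝ 1 h U) (v : V) :
    ∀ᵐ y ∂ν, y ∈ U → h y = 0 → fderiv ℝ h y v = 0 := by
  set D : V → ℝ := fun y => fderiv ℝ h y v
  have hD : ContinuousOn D U :=
    (hh.continuousOn_fderiv_of_isOpen hU le_rfl).clm_apply continuousOn_const
  have hO : IsOpen (U ∩ D ⁻¹' {0}ᶜ) := hD.isOpen_inter_preimage hU isOpen_compl_singleton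
  have hO' : IsOpen (U ∩ h ⁻¹' {0}ᶜ) :=
    hh.continuousOn.isOpen_inter_preimage hU isOpen_compl_singleton
  have hs : MeasurableSet {y | y ∈ U → h y = 0 → D y = 0} := by
    convert (hO.measurableSet.diff hO'.measurableSet).compl using 1
    ext y
    simp only [mem_ofPred_eq, mem_compl_iff, Set.mem_sdiff, mem_inter_iff, mem_preimage,
      mem_singleton_iff]
    tauto
  refine ae_mem_of_ae_add_linearMap_mem (LinearMap.toSpanSingleton ℝ V v) volume ν hs fun y => ?_
  have hc := countable_setOf_zero_deriv_ne_zero fun t : ℝ => h (y + t • v)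
  filter_upwards [compl_mem_ae_iff.2 (hc.measure_zero volume)] with t ht
  simp only [LinearMap.toSpanSingleton_apply]
  intro htU ht0
  by_contra hne
  refine ht ⟨ht0, D (y + t • v), hne, ?_⟩
  have h1 : HasFDerivAt h (fderiv ℝ h (y + t • v)) (y + t • v) :=
    ((hh.contDiffAt (hU.mem_nhds htU)).differentiableAt (by simp)).hasFDerivAt
  have h2 : HasDerivAt (fun t : ℝ => y + t • v) v t := by
    simpa using ((hasDerivAt_id t).smul_const v).const_add y
  exact h1.comp_hasDerivAt t h2

end VectorSpace

variable {n m : ℕ} {M : Type*} [TopologicalSpace M]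
  [ChartedSpace (EuclideanSpace ℝ (Fin n)) M] [IsManifold (𝓡 n) ∞ M]

local notation "𝔼" => EuclideanSpace ℝ (Fin n)

theorem clm_eq_zero_of_single {L : 𝔼 →L[ℝ] ℝ}
    (h : ∀ i, L (EuclideanSpace.single i 1) = 0) : L = 0 := by
  ext v
  have hv : v = ∑ i, v i • EuclideanSpace.single i (1 : ℝ) := by
    ext k; simp [Finset.sum_apply, Pi.single_apply]
  rw [hv]
  simp [map_sum, h]

theorem grad_eq_zero (g : Metric n M) {h : M → ℝ} {x : M}
    (hx : mfderiv (𝓡 n) 𝓘(ℝ, ℝ) h x = 0) : grad g h x = 0 := by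
  by_contra hne
  have h1 := g.pos x _ hne
  rw [inner_grad, hx] at h1
  exact lt_irrefl _ h1

theorem ae_grad_eq_zero (g : Metric n M) (c : M) {φ : M → ℝ}
    (hφ : ContMDiff (𝓡 n) 𝓘(ℝ, ℝ) 1 φ) :
    ∀ᵐ y : 𝔼, y ∈ (extChartAt (𝓡 n) c).target → φ ((extChartAt (𝓡 n) c).symm y) = 0 →
      grad g φ ((extChartAt (𝓡 n) c).symm y) = 0 := by
  have h := ae_all_iff.2 fun i : Fin n =>
    ae_fderiv_eq_zero_of_eq_zero (ν := volume) (isOpen_extChartAt_target c)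
      (contDiffOn_comp_symm (by simp) hφ c) (EuclideanSpace.single i (1 : ℝ))
  filter_upwards [h] with y hy hyT hy0
  refine grad_eq_zero g ?_
  have h0 := clm_eq_zero_of_single fun i => hy i hyT hy0
  ext v
  refine (mfderiv_symm_eq hyT (hφ.mdifferentiable (by simp) _) v).trans ?_
  rw [h0]
  rfl

/-- The functions √(det g) X^i, whose derivatives make up the divergence, all vanish where X does.
-/
theorem ae_chartDiv_eq_zero (g : Metric n M) (c : M) {X : (x : M) → TangentSpace (𝓡 n) x}
    (hX : IsC1Field X) :
    ∀ᵐ y : 𝔼, y ∈ (extChartAt (𝓡 n) c).target → X ((extChartAt (𝓡 n) c).symm y) = 0 →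
      chartDiv g c X y = 0 := by
  have h := ae_all_iff.2 fun i : Fin n =>
    ae_fderiv_eq_zero_of_eq_zero (ν := volume) (isOpen_extChartAt_target c)
      (contDiffOn_volDensity_mul g hX c i) (EuclideanSpace.single i (1 : ℝ))
  filter_upwards [h] with y hy hyT hy0
  have h0 : coordField c X y = 0 := by
    rw [coordField_eq, hy0, map_zero]
  rw [chartDiv, Finset.sum_eq_zero fun i _ => hy i hyT (by rw [h0]; simp), mul_zero]

/-! ### The weighted p-Laplacian on the zero set of u -/

section PLaplacian

variable [CompactSpace M] [T2Space M] [MeasurableSpace M] [BorelSpace M]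

theorem continuous_pLaplacian (g : Metric n M) {f : M → ℝ} (hf : ContMDiff (𝓡 n) 𝓘(ℝ, ℝ) 1 f)
    {p : ℝ} {u : M → EuclideanSpace ℝ (Fin m)} (hX : ∀ k, IsC1Field (flux g p u k)) :
    Continuous (pLaplacian g f p u) :=
  (PiLp.continuous_toLp 2 _).comp (continuous_pi fun k => continuous_weightedDiv g hf (hX k))

/-- The weighted `p`-Laplacian of `u` vanishes almost everywhere on the zero set of `u`. -/
theorem ae_pLaplacian_eq_zero (g : Metric n M) {f : M → ℝ}
    (hf : ContMDiff (𝓡 n) 𝓘(ℝ, ℝ) 1 f) {p : ℝ} {u : M → EuclideanSpace ℝ (Fin m)}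
    (hu : ∀ k, ContMDiff (𝓡 n) 𝓘(ℝ, ℝ) 1 (fun x => u x k))
    (hX : ∀ k, IsC1Field (flux g p u k)) :
    ∀ᵐ x ∂(weightedVolume g f), u x = 0 → pLaplacian g f p u x = 0 := by
  refine (withDensity_absolutelyContinuous _ _).ae_le ?_
  have huc : Continuous u := by
    have := (PiLp.continuous_toLp 2 fun _ : Fin m => ℝ).comp
      (continuous_pi fun k => (hu k).continuous)
    exact this
  have hmeas : MeasurableSet {x | u x = 0 ∧ pLaplacian g f p u x ≠ 0} :=
    (isClosed_eq huc continuous_const).measurableSet.inter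
      (isOpen_ne_fun (continuous_pLaplacian g hf hX) continuous_const).measurableSet
  have hnull : riemannianVolume g {x | u x = 0 ∧ pLaplacian g f p u x ≠ 0} = 0 := by
    refine riemannianVolume_null g hmeas fun c => ?_
    have h1 := ae_all_iff.2 fun k => ae_grad_eq_zero g c (hu k)
    have h2 := ae_all_iff.2 fun k => ae_chartDiv_eq_zero g c ((hX k).smul (contMDiff_exp_neg hf))
    have h3 : ∀ᵐ y : 𝔼, y ∉ (extChartAt (𝓡 n) c).symm ⁻¹'
        {x | u x = 0 ∧ pLaplacian g f p u x ≠ 0} ∩ (extChartAt (𝓡 n) c).target := by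
      filter_upwards [h1, h2] with y hy1 hy2
      rintro ⟨⟨hy0, hyne⟩, hyT⟩
      refine hyne ?_
      ext k
      -- The level set argument is used twice: u = 0 forces ∇u_k = 0 almost everywhere, so the flux
      -- vanishes at almost every zero of u; its weighted divergence then vanishes almost everywhere
      -- on that set.
      have hgr := hy1 k hyT (by rw [hy0]; rfl)
      have hdiv := hy2 k hyT (by rw [flux, hgr, smul_zero, smul_zero])
      simp only [pLaplacian, weightedDiv, PiLp.zero_apply]
      rw [divergence_eq_chartDiv g ((hX k).smul (contMDiff_exp_neg hf)) c
        ((extChartAt (𝓡 n) c).map_target hyT), (extChartAt (𝓡 n) c).right_inv hyT, hdiv, mul_zero]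
    exact compl_mem_ae_iff.1 h3
  filter_upwards [compl_mem_ae_iff.2 hnull] with x hx hx0
  by_contra hne
  exact hx ⟨hx0, hne⟩

end PLaplacian

end WeightedPHeat

namespace WeightedPHeat

open Filter Topology Bundle
/-! ### Positive definite forms on a finite dimensional space -/

section VectorSpace

variable {V Z : Type*} [NormedAddCommGroup V] [NormedSpace ℝ V]
  [NormedAddCommGroup Z] [NormedSpace ℝ Z] [FiniteDimensional ℝ Z]

theorem exists_coercive {B : Z →L[ℝ] Z →L[ℝ] ℝ} (hB : ∀ w ≠ 0, 0 < B w w) :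
    ∃ c > 0, ∀ w, c * ‖w‖ ^ 2 ≤ B w w := by
  have hcont : Continuous fun w => B w w := B.continuous.clm_apply continuous_id
  by_cases hne : (Metric.sphere (0 : Z) 1).Nonempty
  · obtain ⟨w₀, hw₀, hmin⟩ := (isCompact_sphere (0 : Z) 1).exists_isMinOn hne hcont.continuousOn
    refine ⟨B w₀ w₀, hB w₀ (by rintro rfl; simp at hw₀), fun w => ?_⟩
    by_cases hw : w = 0
    · simp [hw]
    have hn : ‖w‖ ≠ 0 := norm_ne_zero_iff.2 hw
    have h1 : ‖w‖⁻¹ • w ∈ Metric.sphere (0 : Z) 1 := by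
      simp [norm_smul, hn]
    have h2 : B w₀ w₀ ≤ B (‖w‖⁻¹ • w) (‖w‖⁻¹ • w) := hmin h1
    simp only [map_smul, smul_apply, smul_eq_mul] at h2
    calc B w₀ w₀ * ‖w‖ ^ 2 ≤ ‖w‖⁻¹ * (‖w‖⁻¹ * B w w) * ‖w‖ ^ 2 := by gcongr
      _ = B w w := by field_simp
  · refine ⟨1, one_pos, fun w => ?_⟩
    have hw : w = 0 := by
      by_contra hw
      exact hne ⟨‖w‖⁻¹ • w, by simp [norm_smul, hw]⟩
    simp [hw]

theorem eventually_coercive {X : Type*} [TopologicalSpace X] {B : X → Z →L[ℝ] Z →L[ℝ] ℝ} {x₀ : X}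
    (hcont : Tendsto (fun x => ‖B x - B x₀‖) (𝓝 x₀) (𝓝 0)) (hB : ∀ w ≠ 0, 0 < B x₀ w w) :
    ∃ c > 0, ∀ᶠ x in 𝓝 x₀, ∀ w, c * ‖w‖ ^ 2 ≤ B x w w := by
  obtain ⟨c, hc, h⟩ := exists_coercive hB
  refine ⟨c / 2, half_pos hc, ?_⟩
  filter_upwards [hcont.eventually_lt_const (half_pos hc)] with x hx w
  have h1 : ‖(B x - B x₀) w w‖ ≤ c / 2 * ‖w‖ * ‖w‖ :=
    ((B x - B x₀).le_opNorm₂ w w).trans (by gcongr)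
  have h2 := (abs_le.1 (Real.norm_eq_abs _ ▸ h1)).1
  simp only [sub_apply] at h2
  nlinarith [h w]

theorem isInvertible_of_pos {B : Z →L[ℝ] Z →L[ℝ] ℝ} (hB : ∀ w ≠ 0, 0 < B w w) :
    B.IsInvertible := by
  have hinj : Function.Injective B.toLinearMap := by
    refine LinearMap.ker_eq_bot.1 (LinearMap.ker_eq_bot'.2 fun w hw => ?_)
    by_contra hne
    have h1 := hB w hne
    have h2 : B w = 0 := hw
    rw [h2] at h1
    exact lt_irrefl _ h1
  have hdim : Module.finrank ℝ Z = Module.finrank ℝ (Z →L[ℝ] ℝ) := by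
    rw [← (LinearMap.toContinuousLinearMap : (Z →ₗ[ℝ] ℝ) ≃ₗ[ℝ] (Z →L[ℝ] ℝ)).finrank_eq]
    exact (Subspace.dual_finrank_eq (K := ℝ) (V := Z)).symm
  exact ⟨(LinearEquiv.ofInjectiveOfFinrankEq B.toLinearMap hinj hdim).toContinuousLinearEquiv,
    by ext; rfl⟩

theorem contDiffOn_inverse {k : WithTop ℕ∞} {U : Set V} {B : V → Z →L[ℝ] Z →L[ℝ] ℝ}
    (hB : ContDiffOn ℝ k B U) (hpos : ∀ y ∈ U, ∀ w ≠ 0, 0 < B y w w) :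
    ContDiffOn ℝ k (fun y => (B y).inverse) U := by
  have : CompleteSpace Z := FiniteDimensional.complete ℝ Z
  intro y hy
  exact (ContinuousLinearMap.IsInvertible.contDiffAt_map_inverse
    (isInvertible_of_pos (hpos y hy))).comp_contDiffWithinAt y (hB y hy)

theorem inverse_apply_eq {B : Z →L[ℝ] Z →L[ℝ] ℝ} (hB : ∀ w ≠ 0, 0 < B w w) {w : Z}
    {l : Z →L[ℝ] ℝ} (h : B w = l) : B.inverse l = w := by
  obtain ⟨e, rfl⟩ := isInvertible_of_pos hB
  rw [ContinuousLinearMap.inverse_equiv, ← h]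
  exact e.symm_apply_apply w

/-! ### Powers of a quadratic form times a field -/

/-- At a zero of the vector factor the product rule needs only continuity of the scalar factor. This
is what handles q^r, which need not be differentiable where q = 0. -/
theorem hasFDerivAt_smul_of_eq_zero {s : V → ℝ} {W : V → Z} {W' : V →L[ℝ] Z} {y : V}
    (hs : ContinuousAt s y) (hW : HasFDerivAt W W' y) (h0 : W y = 0) :
    HasFDerivAt (fun z => s z • W z) (s y • W') y := by
  rw [hasFDerivAt_iff_isLittleO] at hW ⊢
  have h1 : (fun z => s z • (W z - W y - W' (z - y))) =o[𝓝 y] fun z => z - y := by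
    have := (hs.tendsto.isBigO_one ℝ).smul_isLittleO hW
    simpa using this
  have h2 : (fun z => (s z - s y) • W' (z - y)) =o[𝓝 y] fun z => z - y := by
    have h3 : (fun z => s z - s y) =o[𝓝 y] fun _ => (1 : ℝ) := by
      rw [Asymptotics.isLittleO_one_iff]
      simpa using hs.tendsto.sub_const (s y)
    have := h3.smul_isBigO (W'.isBigO_sub (𝓝 y) y)
    simpa using this
  refine (h1.add h2).congr_left fun z => ?_
  simp only [h0, smul_sub, sub_smul, smul_zero, sub_zero, smul_apply]
  abel

theorem continuousWithinAt_of_norm_le {X Y : Type*} [TopologicalSpace X] [NormedAddCommGroup Y]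
    {F : X → Y} {s : Set X} {x : X} {b : X → ℝ} (h0 : F x = 0)
    (hb : Tendsto b (𝓝[s] x) (𝓝 0)) (hF : ∀ᶠ z in 𝓝[s] x, ‖F z‖ ≤ b z) :
    ContinuousWithinAt F s x := by
  rw [ContinuousWithinAt, h0]
  exact squeeze_zero_norm' hF hb

theorem _root_.ContDiffOn.hasFDerivAt_fderiv {Y : Type*} [NormedAddCommGroup Y] [NormedSpace ℝ Y]
    {U : Set V} {F : V → Y} (hF : ContDiffOn ℝ 1 F U) (hU : IsOpen U) {y : V} (hy : y ∈ U) :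
    HasFDerivAt F (fderiv ℝ F y) y :=
  ((hF.contDiffAt (hU.mem_nhds hy)).differentiableAt (by simp)).hasFDerivAt

theorem _root_.ContDiffOn.tendsto_norm_sub {Y : Type*} [NormedAddCommGroup Y] [NormedSpace ℝ Y]
    {U : Set V} {F : V → Y} (hF : ContDiffOn ℝ 1 F U) (hU : IsOpen U) {y : V} (hy : y ∈ U) :
    Tendsto (fun z => ‖F z - F y‖) (𝓝 y) (𝓝 0) :=
  tendsto_iff_norm_sub_tendsto_zero.1 (hF.continuousOn.continuousAt (hU.mem_nhds hy))

theorem _root_.ContDiffOn.eventually_norm_le {Y : Type*} [NormedAddCommGroup Y] [NormedSpace ℝ Y]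
    {U : Set V} {F : V → Y} (hF : ContDiffOn ℝ 1 F U) (hU : IsOpen U) {y : V} (hy : y ∈ U) :
    ∀ᶠ z in 𝓝 y, ‖F z‖ ≤ ‖F y‖ + 1 :=
  (hF.continuousOn.continuousAt (hU.mem_nhds hy)).norm.eventually_le_const (lt_add_one _)

theorem _root_.ContDiffOn.eventually_norm_fderiv_le {Y : Type*} [NormedAddCommGroup Y]
    [NormedSpace ℝ Y] {U : Set V} {F : V → Y} (hF : ContDiffOn ℝ 1 F U) (hU : IsOpen U) {y : V}
    (hy : y ∈ U) : ∀ᶠ z in 𝓝 y, ‖fderiv ℝ F z‖ ≤ ‖fderiv ℝ F y‖ + 1 :=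
  ((hF.continuousOn_fderiv_of_isOpen hU le_rfl).continuousAt
    (hU.mem_nhds hy)).norm.eventually_le_const (lt_add_one _)

/-- With q = B(W, W), the only difficulty is continuity, at zeros of W, of the term r q^{r-1} Dq ⊗ W
of the derivative. Locally |Dq| ≤ C |W| and c |W|² ≤ q, so this term is at most (rC/c) q^r, which
tends to 0 since r > 0. -/
theorem contDiffOn_rpow_smul {U : Set V} (hU : IsOpen U)
    {B : V → Z →L[ℝ] Z →L[ℝ] ℝ} (hB : ContDiffOn ℝ 1 B U)
    (hpos : ∀ y ∈ U, ∀ w ≠ 0, 0 < B y w w) {W : V → Z} (hW : ContDiffOn ℝ 1 W U) {r : ℝ}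
    (hr : 0 < r) : ContDiffOn ℝ 1 (fun y => (B y (W y) (W y)) ^ r • W y) U := by
  set P : V → Z →L[ℝ] ℝ := fun y => B y (W y)
  set q : V → ℝ := fun y => P y (W y)
  have hP : ContDiffOn ℝ 1 P U := hB.clm_apply hW
  have hq : ContDiffOn ℝ 1 q U := hP.clm_apply hW
  have hq0 : ∀ y ∈ U, q y = 0 → W y = 0 := fun y hy h => by
    by_contra hne
    exact (hpos y hy _ hne).ne' h
  -- One formula serves everywhere: at a zero of q also W = 0, so the second summand vanishes
  -- whatever the value of q^{r-1} there.
  set F' : V → V →L[ℝ] Z := fun y =>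
    q y ^ r • fderiv ℝ W y + ((r * q y ^ (r - 1)) • fderiv ℝ q y).smulRight (W y)
  have hrcont : ContinuousOn (fun y => q y ^ r) U :=
    hq.continuousOn.rpow_const fun y _ => Or.inr hr.le
  have hDW := hW.continuousOn_fderiv_of_isOpen hU le_rfl
  have hDq := hq.continuousOn_fderiv_of_isOpen hU le_rfl
  have hder : ∀ y ∈ U, HasFDerivAt (fun y => q y ^ r • W y) (F' y) y := by
    intro y hy
    by_cases hqy : q y = 0
    · have hWy := hq0 y hy hqy
      have := hasFDerivAt_smul_of_eq_zero (hrcont.continuousAt (hU.mem_nhds hy))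
        (hW.hasFDerivAt_fderiv hU hy) hWy
      convert this using 1
      ext v
      simp [F', hWy]
    · exact ((hq.hasFDerivAt_fderiv hU hy).rpow_const (Or.inl hqy)).smul (hW.hasFDerivAt_fderiv hU hy)
  have hF' : ContinuousOn F' U := by
    refine (hrcont.smul hDW).add fun y hy => ?_
    by_cases hqy : q y = 0
    · have hWy := hq0 y hy hqy
      obtain ⟨c, hc, hco⟩ := eventually_coercive (hB.tendsto_norm_sub hU hy)
        (hpos y hy)
      set C := (‖B y‖ + 1) * (‖fderiv ℝ W y‖ + 1) + (‖fderiv ℝ P y‖ + 1)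
      have hlim : Tendsto (fun z => r * C / c * q z ^ r) (𝓝[U] y) (𝓝 0) := by
        have := (hrcont y hy).tendsto.const_mul (r * C / c)
        simpa only [hqy, Real.zero_rpow hr.ne', mul_zero] using this
      refine continuousWithinAt_of_norm_le (by simp [hWy]) hlim ?_
      filter_upwards [nhdsWithin_le_nhds hco, nhdsWithin_le_nhds (hB.eventually_norm_le hU hy),
        nhdsWithin_le_nhds (hW.eventually_norm_fderiv_le hU hy), nhdsWithin_le_nhds (hP.eventually_norm_fderiv_le hU hy), self_mem_nhdsWithin]
        with z h1 h2 h3 h4 hz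
      have hqz : 0 ≤ q z := (by positivity : 0 ≤ c * ‖W z‖ ^ 2).trans (h1 (W z))
      rcases hqz.eq_or_lt with hqz | hqz
      · rw [hq0 z hz hqz.symm, ← hqz, Real.zero_rpow hr.ne']
        simp
      have hD : ‖fderiv ℝ q z‖ ≤ C * ‖W z‖ := by
        have e : fderiv ℝ q z = (P z).comp (fderiv ℝ W z) + (fderiv ℝ P z).flip (W z) :=
          ((hP.hasFDerivAt_fderiv hU hz).clm_apply (hW.hasFDerivAt_fderiv hU hz)).fderiv
        rw [e]
        have i1 : ‖P z‖ ≤ (‖B y‖ + 1) * ‖W z‖ := ((B z).le_opNorm _).trans (by gcongr)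
        have i2 : ‖(P z).comp (fderiv ℝ W z)‖ ≤
            (‖B y‖ + 1) * ‖W z‖ * (‖fderiv ℝ W y‖ + 1) :=
          (ContinuousLinearMap.opNorm_comp_le _ _).trans (by gcongr)
        have i3 : ‖(fderiv ℝ P z).flip (W z)‖ ≤ (‖fderiv ℝ P y‖ + 1) * ‖W z‖ := by
          refine ((fderiv ℝ P z).flip.le_opNorm _).trans ?_
          rw [ContinuousLinearMap.opNorm_flip]
          gcongr
        refine (norm_add_le _ _).trans ((add_le_add i2 i3).trans (le_of_eq ?_))
        simp only [C]; ring
      have hC : 0 ≤ C := by positivity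
      rw [ContinuousLinearMap.norm_smulRight_apply, norm_smul, Real.norm_of_nonneg (by positivity)]
      calc r * q z ^ (r - 1) * ‖fderiv ℝ q z‖ * ‖W z‖
          ≤ r * q z ^ (r - 1) * (C * ‖W z‖) * ‖W z‖ := by gcongr
        _ = r * C / c * q z ^ (r - 1) * (c * ‖W z‖ ^ 2) := by field_simp
        _ ≤ r * C / c * q z ^ (r - 1) * q z := by
            have := h1 (W z)
            gcongr
        _ = r * C / c * q z ^ r := by
            rw [mul_assoc, ← Real.rpow_add_one hqz.ne', sub_add_cancel]
    · have h1 : ContinuousWithinAt (fun z => q z ^ (r - 1)) U y :=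
        (hq.continuousOn y hy).rpow_const (Or.inl hqy)
      have h2 : ContinuousWithinAt (fun z => (r * q z ^ (r - 1)) • fderiv ℝ q z) U y :=
        (continuousWithinAt_const.mul h1).smul (hDq y hy)
      exact ((ContinuousLinearMap.smulRightL ℝ V Z).continuous.continuousAt.comp_continuousWithinAt
        h2).clm_apply (hW.continuousOn y hy)
  intro y hy
  refine ContDiffAt.contDiffWithinAt ?_
  rw [show (1 : WithTop ℕ∞) = 0 + 1 by simp]
  refine (contDiffAt_succ_iff_hasFDerivAt (n := 0)).2 ⟨F', ⟨U, hU.mem_nhds hy, hder⟩, ?_⟩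
  exact (contDiffOn_zero.2 hF').contDiffAt (hU.mem_nhds hy)

/-- The family (W_i) is treated as one field in the product space with the form ∑ B(w_i, w_i'), so
the preceding lemma applies with exponent r/2 and its components give the claim. The exponent r = 0,
that is p = 2, is separate because the lemma needs r > 0. -/
theorem contDiffOn_sqrt_rpow_smul {ι : Type*} [Fintype ι] {U : Set V} (hU : IsOpen U)
    {B : V → Z →L[ℝ] Z →L[ℝ] ℝ} (hB : ContDiffOn ℝ 1 B U)
    (hpos : ∀ y ∈ U, ∀ w ≠ 0, 0 < B y w w) {W : ι → V → Z} (hW : ∀ i, ContDiffOn ℝ 1 (W i) U)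
    {r : ℝ} (hr : 0 ≤ r) (k : ι) :
    ContDiffOn ℝ 1 (fun y => √(∑ i, B y (W i y) (W i y)) ^ r • W k y) U := by
  rcases hr.eq_or_lt with rfl | hr
  · simpa using hW k
  set Bs : V → (ι → Z) →L[ℝ] (ι → Z) →L[ℝ] ℝ := fun y => ∑ i,
    (ContinuousLinearMap.precomp ℝ (ContinuousLinearMap.proj (R := ℝ) (φ := fun _ : ι => Z) i)).comp
      ((B y).comp (ContinuousLinearMap.proj i))
  have hBs : ∀ y w w', Bs y w w' = ∑ i, B y (w i) (w' i) := fun y w w' => by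
    simp [Bs, sum_apply]
  have h := contDiffOn_rpow_smul hU (B := Bs) (W := fun y i => W i y)
    (ContDiffOn.sum fun i _ => contDiffOn_const.clm_comp (hB.clm_comp contDiffOn_const))
    (fun y hy w hw => by
      rw [hBs]
      obtain ⟨i, hi⟩ := Function.ne_iff.1 hw
      refine Finset.sum_pos' (fun j _ => ?_) ⟨i, Finset.mem_univ _, hpos y hy _ hi⟩
      by_cases hj : w j = 0
      · simp [hj]
      · exact (hpos y hy _ hj).le)
    (contDiffOn_pi.2 hW) (half_pos hr)
  refine (contDiffOn_pi.1 h k).congr fun y hy => ?_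
  simp only [hBs, Pi.smul_apply]
  have h0 : 0 ≤ ∑ i, B y (W i y) (W i y) := Finset.sum_nonneg fun i _ => by
    by_cases hj : W i y = 0
    · simp [hj]
    · exact (hpos y hy _ hj).le
  rw [Real.sqrt_eq_rpow, ← Real.rpow_mul h0]
  congr 2
  ring

end VectorSpace

variable {n m : ℕ} {M : Type*} [TopologicalSpace M]
  [ChartedSpace (EuclideanSpace ℝ (Fin n)) M] [IsManifold (𝓡 n) ∞ M]

local notation "𝔼" => EuclideanSpace ℝ (Fin n)

/-! ### The gradient in a chart -/

theorem metricCoord_coordField_grad (g : Metric n M) {φ : M → ℝ} {c : M} {y : 𝔼}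
    (hy : y ∈ (extChartAt (𝓡 n) c).target)
    (hφ : MDifferentiableAt (𝓡 n) 𝓘(ℝ, ℝ) φ ((extChartAt (𝓡 n) c).symm y)) :
    metricCoord g c y (coordField c (grad g φ) y) =
      fderiv ℝ (fun z => φ ((extChartAt (𝓡 n) c).symm z)) y := by
  ext v
  rw [metricCoord_apply, coordField_eq, frameMap_coframeMap hy, inner_grad]
  refine (mfderiv_symm_eq hy hφ _).trans ?_
  rw [coframeMap_frameMap hy]

theorem coordField_grad (g : Metric n M) {φ : M → ℝ} {c : M} {y : 𝔼}
    (hy : y ∈ (extChartAt (𝓡 n) c).target)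
    (hφ : MDifferentiableAt (𝓡 n) 𝓘(ℝ, ℝ) φ ((extChartAt (𝓡 n) c).symm y)) :
    coordField c (grad g φ) y = (metricCoord g c y).inverse
      (fderiv ℝ (fun z => φ ((extChartAt (𝓡 n) c).symm z)) y) :=
  (inverse_apply_eq (fun _ => metricCoord_pos g hy) (metricCoord_coordField_grad g hy hφ)).symm

/-- The right-hand side involves only differentials in a fixed dual space and a matrix inverse that
does not depend on time. Regularity in time of |∇u|² is read off from it. -/
theorem inner_grad_grad (g : Metric n M) {φ χ : M → ℝ} {c : M} {y : 𝔼}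
    (hy : y ∈ (extChartAt (𝓡 n) c).target)
    (hφ : MDifferentiableAt (𝓡 n) 𝓘(ℝ, ℝ) φ ((extChartAt (𝓡 n) c).symm y))
    (hχ : MDifferentiableAt (𝓡 n) 𝓘(ℝ, ℝ) χ ((extChartAt (𝓡 n) c).symm y)) :
    g.inner ((extChartAt (𝓡 n) c).symm y) (grad g φ ((extChartAt (𝓡 n) c).symm y))
        (grad g χ ((extChartAt (𝓡 n) c).symm y)) =
      fderiv ℝ (fun z => φ ((extChartAt (𝓡 n) c).symm z)) y ((metricCoord g c y).inverse
        (fderiv ℝ (fun z => χ ((extChartAt (𝓡 n) c).symm z)) y)) := by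
  rw [← coordField_grad g hy hχ, inner_grad]
  exact mfderiv_symm_eq hy hφ _

theorem contDiffOn_coordField_grad (g : Metric n M) {φ : M → ℝ}
    (hφ : ContMDiff (𝓡 n) 𝓘(ℝ, ℝ) ∞ φ) (c : M) :
    ContDiffOn ℝ 1 (coordField c (grad g φ)) (extChartAt (𝓡 n) c).target := by
  have h1 : ContDiffOn ℝ 1 (fun y => (metricCoord g c y).inverse) (extChartAt (𝓡 n) c).target :=
    contDiffOn_inverse ((contDiffOn_metricCoord g c).of_le (by simp))
      fun y hy _ => metricCoord_pos g hy
  have h2 : ContDiffOn ℝ 1 (fderiv ℝ fun z => φ ((extChartAt (𝓡 n) c).symm z))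
      (extChartAt (𝓡 n) c).target :=
    (contDiffOn_comp_symm le_rfl hφ c).fderiv_of_isOpen (isOpen_extChartAt_target c)
      (WithTop.coe_le_coe.2 le_top)
  exact (h1.clm_apply h2).congr fun y hy =>
    coordField_grad g hy (hφ.mdifferentiable (by simp) _)

/-- For `p ≥ 2` the flux `|∇u|^{p-2} ∇u` of a smooth map is `C^1`. -/
theorem isC1Field_flux (g : Metric n M) {p : ℝ} (hp : 2 ≤ p) {u : M → EuclideanSpace ℝ (Fin m)}
    (hu : ∀ k, ContMDiff (𝓡 n) 𝓘(ℝ, ℝ) ∞ (fun x => u x k)) (k : Fin m) :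
    IsC1Field (flux g p u k) := by
  refine (contMDiff_field_iff (by simp) _).2 fun c => ?_
  refine (contDiffOn_sqrt_rpow_smul (isOpen_extChartAt_target c)
    ((contDiffOn_metricCoord g c).of_le (by simp)) (fun y hy _ => metricCoord_pos g hy)
    (fun i => contDiffOn_coordField_grad g (hu i) c) (sub_nonneg.2 hp) k).congr fun y hy => ?_
  rw [coordField_eq, flux, map_smul, gradNorm]
  refine congrArg₂ _ ?_ rfl
  congr 2
  refine Finset.sum_congr rfl fun i _ => ?_
  rw [metricCoord_apply, coordField_eq, frameMap_coframeMap hy]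

end WeightedPHeat

namespace WeightedPHeat

open Filter Topology Bundle
/-! ### Mixed derivatives on a cylinder -/

section VectorSpace

variable {V W : Type*} [NormedAddCommGroup V] [NormedSpace ℝ V]
  [NormedAddCommGroup W] [NormedSpace ℝ W] {a b : ℝ} {T : Set V} {H : ℝ × V → W}

theorem uniqueDiffOn_cylinder (hab : a < b) (hT : IsOpen T) :
    UniqueDiffOn ℝ (Icc a b ×ˢ T : Set (ℝ × V)) :=
  (uniqueDiffOn_Icc hab).prod hT.uniqueDiffOn

theorem cylinder_subset_closure_interior (hab : a < b) (hT : IsOpen T) :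
    (Icc a b ×ˢ T : Set (ℝ × V)) ⊆ closure (interior (Icc a b ×ˢ T)) := by
  rw [interior_prod_eq, interior_Icc, hT.interior_eq, closure_prod_eq, closure_Ioo hab.ne]
  exact prod_mono subset_rfl subset_closure

theorem hasFDerivAt_slice (hT : IsOpen T) {s : ℝ} (hs : s ∈ Icc a b)
    {y : V} (hy : y ∈ T) {L : ℝ × V →L[ℝ] W} (hH : HasFDerivWithinAt H L (Icc a b ×ˢ T) (s, y)) :
    HasFDerivAt (fun z => H (s, z)) (L.comp (ContinuousLinearMap.inr ℝ ℝ V)) y := by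
  have h1 : HasFDerivWithinAt (fun z : V => (s, z)) (ContinuousLinearMap.inr ℝ ℝ V) T y :=
    (hasFDerivAt_prodMk_right s y).hasFDerivWithinAt
  exact (HasFDerivWithinAt.comp y hH h1 fun z hz => ⟨hs, hz⟩).hasFDerivAt (hT.mem_nhds hy)

theorem hasDerivWithinAt_slice {s : ℝ} {y : V} (hy : y ∈ T) {L : ℝ × V →L[ℝ] W}
    (hH : HasFDerivWithinAt H L (Icc a b ×ˢ T) (s, y)) :
    HasDerivWithinAt (fun r => H (r, y)) (L (1, 0)) (Icc a b) s := by
  have h1 : HasFDerivWithinAt (fun r : ℝ => (r, y)) (ContinuousLinearMap.inl ℝ ℝ V) (Icc a b) s :=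
    (hasFDerivAt_prodMk_left s y).hasFDerivWithinAt
  have h2 := (HasFDerivWithinAt.comp s hH h1
    (show MapsTo (fun r : ℝ => (r, y)) (Icc a b) (Icc a b ×ˢ T) from
      fun z hz => ⟨hz, hy⟩)).hasDerivWithinAt
  simpa [Function.comp_def] using h2

theorem contDiffOn_timeDeriv (hab : a < b) (hT : IsOpen T)
    (hH : ContDiffOn ℝ ∞ H (Icc a b ×ˢ T)) :
    ContDiffOn ℝ ∞ (fun z : ℝ × V => derivWithin (fun r => H (r, z.2)) (Icc a b) z.1)
      (Icc a b ×ˢ T) := by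
  have h1 := (hH.fderivWithin (uniqueDiffOn_cylinder hab hT) (m := ∞) (by simp)).clm_apply
    (contDiffOn_const (c := ((1 : ℝ), (0 : V))))
  refine h1.congr fun z hz => ?_
  exact (hasDerivWithinAt_slice hz.2
    ((hH.differentiableOn (by simp)) z hz).hasFDerivWithinAt).derivWithin
      (uniqueDiffOn_Icc hab _ hz.1)

theorem hasDerivWithinAt_timeDeriv (hH : ContDiffOn ℝ ∞ H (Icc a b ×ˢ T))
    {s : ℝ} (hs : s ∈ Icc a b) {y : V} (hy : y ∈ T) :
    HasDerivWithinAt (fun r => H (r, y)) (derivWithin (fun r => H (r, y)) (Icc a b) s)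
      (Icc a b) s := by
  have h := hasDerivWithinAt_slice hy
    ((hH.differentiableOn (by simp)) (s, y) ⟨hs, hy⟩).hasFDerivWithinAt
  exact h.differentiableWithinAt.hasDerivWithinAt

theorem contDiffOn_spaceDeriv (hab : a < b) (hT : IsOpen T)
    (hH : ContDiffOn ℝ ∞ H (Icc a b ×ˢ T)) :
    ContDiffOn ℝ ∞ (fun z : ℝ × V => fderiv ℝ (fun x => H (z.1, x)) z.2) (Icc a b ×ˢ T) := by
  have h1 := (hH.fderivWithin (uniqueDiffOn_cylinder hab hT) (m := ∞) (by simp)).clm_comp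
    (contDiffOn_const (c := ContinuousLinearMap.inr ℝ ℝ V))
  exact h1.congr fun z hz => (hasFDerivAt_slice hT hz.1 hz.2
    ((hH.differentiableOn (by simp)) z hz).hasFDerivWithinAt).fderiv

/-- Time and space derivatives commute, up to the endpoints of the time interval. -/
theorem hasDerivWithinAt_spaceDeriv (hab : a < b) (hT : IsOpen T)
    (hH : ContDiffOn ℝ ∞ H (Icc a b ×ˢ T)) {s : ℝ} (hs : s ∈ Icc a b) {y : V} (hy : y ∈ T) :
    HasDerivWithinAt (fun r => fderiv ℝ (fun x => H (r, x)) y)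
      (fderiv ℝ (fun x => derivWithin (fun r => H (r, x)) (Icc a b) s) y) (Icc a b) s := by
  set S : Set (ℝ × V) := Icc a b ×ˢ T
  have hS : UniqueDiffOn ℝ S := uniqueDiffOn_cylinder hab hT
  set D := fderivWithin ℝ H S
  have hD : ContDiffOn ℝ ∞ D S := hH.fderivWithin hS (by simp)
  have hz : (s, y) ∈ S := ⟨hs, hy⟩
  have hD2 : HasFDerivWithinAt D (fderivWithin ℝ D S (s, y)) S (s, y) :=
    ((hD.differentiableOn (by simp)) _ hz).hasFDerivWithinAt
  -- Symmetry of the second derivative persists at the endpoint times because the cylinder lies in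
  -- the closure of its interior.
  have hsymm : IsSymmSndFDerivWithinAt ℝ H S (s, y) :=
    (hH (s, y) hz).isSymmSndFDerivWithinAt (by simp; exact WithTop.coe_le_coe.2 le_top) hS
      (cylinder_subset_closure_interior hab hT hz) hz
  have hspace : ∀ r ∈ Icc a b, fderiv ℝ (fun x => H (r, x)) y =
      (D (r, y)).comp (ContinuousLinearMap.inr ℝ ℝ V) := fun r hr =>
    (hasFDerivAt_slice hT hr hy
      ((hH.differentiableOn (by simp)) (r, y) ⟨hr, hy⟩).hasFDerivWithinAt).fderiv
  have htime : ∀ x ∈ T, derivWithin (fun r => H (r, x)) (Icc a b) s = D (s, x) (1, 0) :=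
    fun x hx => (hasDerivWithinAt_slice hx
      ((hH.differentiableOn (by simp)) (s, x) ⟨hs, hx⟩).hasFDerivWithinAt).derivWithin
        (uniqueDiffOn_Icc hab _ hs)
  have h1 : fderiv ℝ (fun x => derivWithin (fun r => H (r, x)) (Icc a b) s) y =
      ((fderivWithin ℝ D S (s, y)).flip (1, 0)).comp (ContinuousLinearMap.inr ℝ ℝ V) := by
    have h2 : HasFDerivWithinAt (fun z => D z (1, 0))
        ((fderivWithin ℝ D S (s, y)).flip (1, 0)) S (s, y) := by
      have := hD2.clm_apply (hasFDerivWithinAt_const ((1 : ℝ), (0 : V)) (s, y) S)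
      simpa using this
    have h3 := (hasFDerivAt_slice hT hs hy h2).fderiv
    rw [← h3]
    refine Filter.EventuallyEq.fderiv_eq ?_
    filter_upwards [hT.mem_nhds hy] with x hx using htime x hx
  have h2 : HasDerivWithinAt (fun r => (D (r, y)).comp (ContinuousLinearMap.inr ℝ ℝ V))
      ((fderivWithin ℝ D S (s, y) (1, 0)).comp (ContinuousLinearMap.inr ℝ ℝ V)) (Icc a b) s := by
    have h3 := hasDerivWithinAt_slice hy hD2
    have := ((ContinuousLinearMap.precomp W (ContinuousLinearMap.inr ℝ ℝ V)).hasFDerivAt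
      (x := D (s, y))).comp_hasDerivWithinAt s h3
    exact this
  rw [h1]
  have h3 : ((fderivWithin ℝ D S (s, y)).flip (1, 0)).comp (ContinuousLinearMap.inr ℝ ℝ V) =
      (fderivWithin ℝ D S (s, y) (1, 0)).comp (ContinuousLinearMap.inr ℝ ℝ V) := by
    ext v
    exact hsymm _ _
  rw [h3]
  exact h2.congr (fun r hr => hspace r hr) (hspace s hs)

end VectorSpace

variable {n m : ℕ} {M : Type*} [TopologicalSpace M]
  [ChartedSpace (EuclideanSpace ℝ (Fin n)) M] [IsManifold (𝓡 n) ∞ M]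

local notation "𝔼" => EuclideanSpace ℝ (Fin n)

/-! ### Smooth families of functions on the manifold -/

/-- A family `h t`, `a ≤ t ≤ b`, of functions on `M` that is smooth in `(t, x)`, read in charts. -/
def IsSmoothFamily (n : ℕ) {M : Type*} [TopologicalSpace M]
    [ChartedSpace (EuclideanSpace ℝ (Fin n)) M] {W : Type*} [NormedAddCommGroup W]
    [NormedSpace ℝ W] (a b : ℝ) (h : ℝ → M → W) : Prop :=
  ∀ c : M, ContDiffOn ℝ ∞ (fun z : ℝ × EuclideanSpace ℝ (Fin n) =>
    h z.1 ((extChartAt (𝓡 n) c).symm z.2)) (Icc a b ×ˢ (extChartAt (𝓡 n) c).target)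

variable {W : Type*} [NormedAddCommGroup W] [NormedSpace ℝ W] {a b : ℝ}

theorem isSmoothFamily_of_contMDiffOn {h : ℝ → M → W}
    (hh : ContMDiffOn (𝓘(ℝ, ℝ).prod (𝓡 n)) 𝓘(ℝ, W) ∞ (Function.uncurry h)
      (Icc a b ×ˢ univ)) : IsSmoothFamily n a b h := by
  intro c
  rw [← contMDiffOn_iff_contDiffOn]
  have h1 : ContMDiffOn 𝓘(ℝ, ℝ × 𝔼) 𝓘(ℝ, ℝ) ∞ (fun z : ℝ × 𝔼 => z.1)
      (Icc a b ×ˢ (extChartAt (𝓡 n) c).target) := contDiff_fst.contMDiff.contMDiffOn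
  have h2 : ContMDiffOn 𝓘(ℝ, ℝ × 𝔼) 𝓘(ℝ, 𝔼) ∞ (fun z : ℝ × 𝔼 => z.2)
      (Icc a b ×ˢ (extChartAt (𝓡 n) c).target) := contDiff_snd.contMDiff.contMDiffOn
  have h3 := (contMDiffOn_extChartAt_symm' (n := n) c).comp h2 fun z hz => hz.2
  exact hh.comp (h1.prodMk h3) fun z hz => ⟨hz.1, mem_univ _⟩

theorem contMDiff_of_contDiffOn_charts {k : WithTop ℕ∞} (hk : k ≤ ∞) {F : M → W}
    (h : ∀ c : M, ContDiffOn ℝ k (fun y => F ((extChartAt (𝓡 n) c).symm y))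
      (extChartAt (𝓡 n) c).target) : ContMDiff (𝓡 n) 𝓘(ℝ, W) k F := by
  have : IsManifold (𝓡 n) k M := IsManifold.of_le hk
  intro x
  have h1 := ((h x).contDiffAt ((isOpen_extChartAt_target (I := 𝓡 n) x).mem_nhds
    (mem_extChartAt_target x))).contMDiffAt
  have h3 := h1.comp x (contMDiffAt_extChartAt' (I := 𝓡 n) (n := k) (mem_chart_source _ x))
  refine h3.congr_of_eventuallyEq ?_
  filter_upwards [extChartAt_source_mem_nhds (I := 𝓡 n) x] with z hz
  simp only [Function.comp, (extChartAt (𝓡 n) x).left_inv hz]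

theorem IsSmoothFamily.contMDiff {h : ℝ → M → W} (hh : IsSmoothFamily n a b h) {s : ℝ}
    (hs : s ∈ Icc a b) : ContMDiff (𝓡 n) 𝓘(ℝ, W) ∞ (h s) :=
  contMDiff_of_contDiffOn_charts le_rfl fun c =>
    (hh c).comp (f := fun y => (s, y)) (contDiffOn_const.prodMk contDiffOn_id)
      fun _ hy => ⟨hs, hy⟩

theorem IsSmoothFamily.mdifferentiableAt {h : ℝ → M → W} (hh : IsSmoothFamily n a b h) {s : ℝ}
    (hs : s ∈ Icc a b) (x : M) : MDifferentiableAt (𝓡 n) 𝓘(ℝ, W) (h s) x :=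
  (hh.contMDiff hs).mdifferentiable (by simp) x

/-- The time derivative of a family of functions. -/
noncomputable def timeDeriv (a b : ℝ) (h : ℝ → M → W) (s : ℝ) (x : M) : W :=
  derivWithin (fun r => h r x) (Icc a b) s

theorem IsSmoothFamily.timeDeriv (hab : a < b) {h : ℝ → M → W} (hh : IsSmoothFamily n a b h) :
    IsSmoothFamily n a b (timeDeriv a b h) := fun c =>
  contDiffOn_timeDeriv hab (isOpen_extChartAt_target c) (hh c)

theorem IsSmoothFamily.hasDerivWithinAt {h : ℝ → M → W}
    (hh : IsSmoothFamily n a b h) {s : ℝ} (hs : s ∈ Icc a b) (x : M) :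
    HasDerivWithinAt (fun r => h r x) (WeightedPHeat.timeDeriv a b h s x) (Icc a b) s := by
  have := hasDerivWithinAt_timeDeriv (hh x) hs (mem_extChartAt_target x)
  simp only [extChartAt_to_inv] at this
  exact this

theorem continuousOn_uncurry_of_charts {Y : Type*} [TopologicalSpace Y] {F : ℝ → M → Y}
    (h : ∀ c : M, ContinuousOn (fun z : ℝ × 𝔼 => F z.1 ((extChartAt (𝓡 n) c).symm z.2))
      (Icc a b ×ˢ (extChartAt (𝓡 n) c).target)) :
    ContinuousOn (Function.uncurry F) (Icc a b ×ˢ univ) := by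
  rintro ⟨s, x⟩ ⟨hs, -⟩
  set O : Set (ℝ × M) := univ ×ˢ (extChartAt (𝓡 n) x).source
  have hO : O ∈ 𝓝 (s, x) := (isOpen_univ.prod (isOpen_extChartAt_source x)).mem_nhds
    ⟨mem_univ _, mem_extChartAt_source x⟩
  refine ContinuousWithinAt.mono_of_mem_nhdsWithin (t := (Icc a b ×ˢ univ) ∩ O) ?_
    (inter_mem self_mem_nhdsWithin (mem_nhdsWithin_of_mem_nhds hO))
  have h1 : ContinuousOn (fun z : ℝ × M => (z.1, extChartAt (𝓡 n) x z.2))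
      ((Icc a b ×ˢ univ) ∩ O) :=
    continuousOn_fst.prodMk ((continuousOn_extChartAt x).comp continuousOn_snd fun z hz => hz.2.2)
  have h2 := (h x).comp h1 fun z hz => ⟨hz.1.1, (extChartAt (𝓡 n) x).map_source hz.2.2⟩
  refine (h2.congr fun z hz => ?_) (s, x) ⟨⟨hs, mem_univ _⟩, mem_univ _, mem_extChartAt_source x⟩
  simp only [Function.comp, (extChartAt (𝓡 n) x).left_inv hz.2.2]
  rfl

theorem IsSmoothFamily.continuousOn {h : ℝ → M → W} (hh : IsSmoothFamily n a b h) :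
    ContinuousOn (Function.uncurry h) (Icc a b ×ˢ univ) :=
  continuousOn_uncurry_of_charts fun c => (hh c).continuousOn

theorem exists_bound_uncurry [CompactSpace M] {F : ℝ → M → ℝ}
    (hF : ContinuousOn (Function.uncurry F) (Icc a b ×ˢ univ)) :
    ∃ C, ∀ s ∈ Icc a b, ∀ x, |F s x| ≤ C := by
  obtain ⟨C, hC⟩ := (isCompact_Icc.prod isCompact_univ).exists_bound_of_continuousOn hF
  exact ⟨C, fun s hs x => hC (s, x) ⟨hs, mem_univ _⟩⟩

theorem continuousOn_inner_grad (hab : a < b) (g : Metric n M) {h k : ℝ → M → ℝ}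
    (hh : IsSmoothFamily n a b h) (hk : IsSmoothFamily n a b k) :
    ContinuousOn (Function.uncurry fun s x => g.inner x (grad g (h s) x) (grad g (k s) x))
      (Icc a b ×ˢ univ) := by
  refine continuousOn_uncurry_of_charts (n := n) fun c => ?_
  have hA : ContinuousOn (fun z : ℝ × 𝔼 => (metricCoord g c z.2).inverse)
      (Icc a b ×ˢ (extChartAt (𝓡 n) c).target) :=
    (contDiffOn_inverse (contDiffOn_metricCoord g c)
      fun y hy _ => metricCoord_pos g hy).continuousOn.comp continuousOn_snd fun z hz => hz.2
  have hT := isOpen_extChartAt_target (I := 𝓡 n) c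
  refine ((contDiffOn_spaceDeriv hab hT (hh c)).continuousOn.clm_apply
    (hA.clm_apply (contDiffOn_spaceDeriv hab hT (hk c)).continuousOn)).congr fun z hz => ?_
  exact inner_grad_grad g hz.2 (hh.mdifferentiableAt hz.1 _) (hk.mdifferentiableAt hz.1 _)

theorem hasDerivWithinAt_inner_grad (hab : a < b) (g : Metric n M) {h : ℝ → M → ℝ}
    (hh : IsSmoothFamily n a b h) {s : ℝ} (hs : s ∈ Icc a b) (x : M) :
    HasDerivWithinAt (fun r => g.inner x (grad g (h r) x) (grad g (h r) x))
      (2 * g.inner x (grad g (timeDeriv a b h s) x) (grad g (h s) x)) (Icc a b) s := by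
  -- The claim is proved at the image of an arbitrary coordinate point and transported to `x` only
  -- at the end, since the tangent space depends on the base point.
  have key : ∀ c : M, ∀ y ∈ (extChartAt (𝓡 n) c).target,
      HasDerivWithinAt (fun r => g.inner ((extChartAt (𝓡 n) c).symm y)
        (grad g (h r) ((extChartAt (𝓡 n) c).symm y)) (grad g (h r) ((extChartAt (𝓡 n) c).symm y)))
      (2 * g.inner ((extChartAt (𝓡 n) c).symm y)
        (grad g (timeDeriv a b h s) ((extChartAt (𝓡 n) c).symm y))
        (grad g (h s) ((extChartAt (𝓡 n) c).symm y))) (Icc a b) s := by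
    intro c y hy
    have hd := fun r (hr : r ∈ Icc a b) =>
      hh.mdifferentiableAt hr ((extChartAt (𝓡 n) c).symm y)
    have hd' := (hh.timeDeriv hab).mdifferentiableAt hs ((extChartAt (𝓡 n) c).symm y)
    have hD := hasDerivWithinAt_spaceDeriv hab (isOpen_extChartAt_target (I := 𝓡 n) c) (hh c) hs hy
    set A := (metricCoord g c y).inverse
    have hA : HasDerivWithinAt (fun r => A (fderiv ℝ (fun z => h r ((extChartAt (𝓡 n) c).symm z)) y))
        _ (Icc a b) s := A.hasFDerivAt.comp_hasDerivWithinAt s hD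
    have h1 := (hD.clm_apply hA).congr (fun r hr => inner_grad_grad g hy (hd r hr) (hd r hr))
      (inner_grad_grad g hy (hd s hs) (hd s hs))
    have e1 := inner_grad_grad g hy hd' (hd s hs)
    have e2 := inner_grad_grad g hy (hd s hs) hd'
    rw [g.symm] at e2
    exact h1.congr_deriv ((congrArg₂ (· + ·) e1 e2).symm.trans (two_mul _).symm)
  have := key x _ (mem_extChartAt_target x)
  rwa [extChartAt_to_inv] at this

/-- The differential of `h r` is differentiable in r and vanishes at r = s, so it is O(r - s), and
|∇h|² is quadratic in it. This rate is needed for the power |∇u|^p with p < 2. -/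
theorem isBigO_inner_grad (hab : a < b) (g : Metric n M) {h : ℝ → M → ℝ}
    (hh : IsSmoothFamily n a b h) {s : ℝ} (hs : s ∈ Icc a b) (x : M)
    (h0 : grad g (h s) x = 0) :
    (fun r => g.inner x (grad g (h r) x) (grad g (h r) x)) =O[𝓝[Icc a b] s]
      fun r => (r - s) ^ 2 := by
  have key : ∀ c : M, ∀ y ∈ (extChartAt (𝓡 n) c).target,
      grad g (h s) ((extChartAt (𝓡 n) c).symm y) = 0 →
      (fun r => g.inner ((extChartAt (𝓡 n) c).symm y)
        (grad g (h r) ((extChartAt (𝓡 n) c).symm y)) (grad g (h r) ((extChartAt (𝓡 n) c).symm y)))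
      =O[𝓝[Icc a b] s] fun r => (r - s) ^ 2 := by
    intro c y hy h0
    have hd := fun r (hr : r ∈ Icc a b) =>
      hh.mdifferentiableAt hr ((extChartAt (𝓡 n) c).symm y)
    have hD := hasDerivWithinAt_spaceDeriv hab (isOpen_extChartAt_target (I := 𝓡 n) c) (hh c) hs hy
    have hz : fderiv ℝ (fun z => h s ((extChartAt (𝓡 n) c).symm z)) y = 0 := by
      rw [← metricCoord_coordField_grad g hy (hd s hs)]
      have h1 : coordField c (grad g (h s)) y = 0 := by
        rw [coordField, h0, map_zero]
        rfl
      rw [h1, map_zero]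
    have hO : (fun r => fderiv ℝ (fun z => h r ((extChartAt (𝓡 n) c).symm z)) y)
        =O[𝓝[Icc a b] s] fun r => r - s := by
      refine hD.hasFDerivWithinAt.isBigO_sub.congr_left fun r => ?_
      exact (congrArg _ hz).trans (sub_zero _)
    set A := (metricCoord g c y).inverse
    have hA : (fun r => A (fderiv ℝ (fun z => h r ((extChartAt (𝓡 n) c).symm z)) y))
        =O[𝓝[Icc a b] s] fun r => r - s := (A.isBigO_comp _ _).trans hO
    have h1 : (fun r => fderiv ℝ (fun z => h r ((extChartAt (𝓡 n) c).symm z)) y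
        (A (fderiv ℝ (fun z => h r ((extChartAt (𝓡 n) c).symm z)) y)))
        =O[𝓝[Icc a b] s] fun r => (r - s) ^ 2 := by
      refine (Asymptotics.IsBigO.of_bound 1 (Eventually.of_forall fun r => ?_)).trans
        ((hO.norm_left.mul hA.norm_left).congr_right fun r => (sq _).symm)
      rw [one_mul]
      exact (ContinuousLinearMap.le_opNorm _ _).trans (le_abs_self _)
    refine h1.congr' ?_ EventuallyEq.rfl
    filter_upwards [self_mem_nhdsWithin] with r hr
    exact (inner_grad_grad g hy (hd r hr) (hd r hr)).symm
  have := key x _ (mem_extChartAt_target x)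
  rw [extChartAt_to_inv] at this
  exact this h0

end WeightedPHeat

namespace WeightedPHeat

open Filter Topology Bundle
/-! ### Calculus lemmas -/

/-- Away from zeros this is the chain rule for q^{p/2}. At a zero the chain rule may fail, as p/2
can be below 1, but q = O((r - s)²) gives q^{p/2} = O(|r - s|^p) = o(r - s), because p > 1. -/
theorem hasDerivWithinAt_sqrt_rpow {q : ℝ → ℝ} {q' s p : ℝ} {S : Set ℝ} (hp : 1 < p)
    (hq0 : ∀ r, 0 ≤ q r) (hq : HasDerivWithinAt q q' S s)
    (hz : q s = 0 → q' = 0 ∧ q =O[𝓝[S] s] fun r => (r - s) ^ 2) :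
    HasDerivWithinAt (fun r => √(q r) ^ p) (p * (√(q s) ^ (p - 2) * (q' / 2))) S s := by
  have hpow : ∀ (r e : ℝ), √(q r) ^ e = q r ^ (e / 2) := fun r e => by
    rw [Real.sqrt_eq_rpow, ← Real.rpow_mul (hq0 r)]; ring_nf
  simp only [hpow]
  by_cases h : q s = 0
  · obtain ⟨rfl, hO⟩ := hz h
    have h1 : (fun r => q r ^ (p / 2)) =O[𝓝[S] s] fun r => ((r - s) ^ 2) ^ (p / 2) :=
      hO.rpow (by linarith) (Eventually.of_forall fun r => sq_nonneg _)
    have h2 : (fun r => ((r - s) ^ 2) ^ (p / 2)) =o[𝓝[S] s] fun r => r - s := by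
      have h3 : Tendsto (fun r : ℝ => |r - s| ^ (p - 1)) (𝓝[S] s) (𝓝 0) := by
        have : ContinuousAt (fun r : ℝ => |r - s| ^ (p - 1)) s :=
          (continuous_abs.comp (continuous_id.sub continuous_const)).continuousAt.rpow_const
            (Or.inr (by linarith))
        have h4 := this.tendsto
        simp only [sub_self, abs_zero, Real.zero_rpow (by linarith : p - 1 ≠ 0)] at h4
        exact h4.mono_left nhdsWithin_le_nhds
      have h5 : (fun r => |r - s| ^ (p - 1) * |r - s|) =o[𝓝[S] s] fun r => 1 * |r - s| :=
        ((Asymptotics.isLittleO_one_iff ℝ).2 h3).mul_isBigO (Asymptotics.isBigO_refl _ _)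
      simp only [one_mul, Asymptotics.isLittleO_abs_right] at h5
      refine h5.congr_left fun r => ?_
      rcases eq_or_ne (r - s) 0 with h0 | h0
      · rw [h0, abs_zero, mul_zero, zero_pow two_ne_zero, Real.zero_rpow (by linarith)]
      · rw [← Real.rpow_add_one (abs_ne_zero.2 h0), ← sq_abs, ← Real.rpow_natCast,
          ← Real.rpow_mul (abs_nonneg _)]
        congr 1
        push_cast
        ring
    rw [hasDerivWithinAt_iff_isLittleO]
    refine (h1.trans_isLittleO h2).congr_left fun r => ?_
    rw [h, Real.zero_rpow (by linarith)]
    simp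
  · refine (hq.rpow_const (p := p / 2) (Or.inl h)).congr_deriv ?_
    rw [show p / 2 - 1 = (p - 2) / 2 by ring]
    ring

/-- By the mean value inequality on the interval, `C` bounds all difference quotients, so dominated
convergence applies; working within `Icc a b` includes the endpoints. -/
theorem hasDerivWithinAt_integral_Icc {X : Type*} [MeasurableSpace X] {μ : Measure X}
    [IsFiniteMeasure μ] {a b C : ℝ} {F F' : ℝ → X → ℝ}
    (hF : ∀ s ∈ Icc a b, Integrable (F s) μ)
    (hd : ∀ s ∈ Icc a b, ∀ x, HasDerivWithinAt (fun r => F r x) (F' s x) (Icc a b) s)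
    (hC : ∀ s ∈ Icc a b, ∀ x, |F' s x| ≤ C) {s : ℝ} (hs : s ∈ Icc a b) :
    HasDerivWithinAt (fun r => ∫ x, F r x ∂μ) (∫ x, F' s x ∂μ) (Icc a b) s := by
  rw [hasDerivWithinAt_iff_tendsto_slope]
  have hmem : ∀ᶠ r in 𝓝[Icc a b \ {s}] s, r ∈ Icc a b :=
    mem_of_superset self_mem_nhdsWithin sdiff_subset
  have h1 : Tendsto (fun r => ∫ x, slope (fun r => F r x) s r ∂μ) (𝓝[Icc a b \ {s}] s)
      (𝓝 (∫ x, F' s x ∂μ)) := by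
    refine tendsto_integral_filter_of_dominated_convergence (fun _ => C) ?_ ?_
      (integrable_const C) ?_
    · filter_upwards [hmem] with r hr
      simp only [slope_def_field]
      exact (((hF r hr).sub (hF s hs)).div_const _).aestronglyMeasurable
    · filter_upwards [hmem, self_mem_nhdsWithin] with r hr hrs
      refine Eventually.of_forall fun x => ?_
      have h2 := (convex_Icc a b).norm_image_sub_le_of_norm_hasDerivWithin_le
        (fun t ht => hd t ht x) (fun t ht => hC t ht x) hs hr
      rw [slope_def_field, norm_div, div_le_iff₀ (norm_pos_iff.2 (sub_ne_zero.2 hrs.2))]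
      exact h2
    · exact Eventually.of_forall fun x => hasDerivWithinAt_iff_tendsto_slope.1 (hd s hs x)
  refine h1.congr' ?_
  filter_upwards [hmem] with r hr
  simp only [slope_def_field]
  rw [integral_div, integral_sub (hF r hr) (hF s hs)]

/-- For p < 2 the factor |u|^{p-2} is unbounded near u = 0; the bound by |u|^{p-1} stays continuous
there and supplies integrability and domination. -/
theorem abs_norm_rpow_mul_inner_le {E : Type*} [NormedAddCommGroup E] [InnerProductSpace ℝ E]
    {p : ℝ} (hp : 1 < p) (u v : E) :
    |‖u‖ ^ (p - 2) * inner ℝ u v| ≤ ‖u‖ ^ (p - 1) * ‖v‖ := by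
  rw [abs_mul, abs_of_nonneg (by positivity)]
  refine (mul_le_mul_of_nonneg_left (abs_real_inner_le_norm u v) (by positivity)).trans ?_
  rw [← mul_assoc]
  refine mul_le_mul_of_nonneg_right ?_ (norm_nonneg v)
  rcases (norm_nonneg u).eq_or_lt with h | h
  · rw [← h, mul_zero, Real.zero_rpow (by linarith)]
  · rw [← Real.rpow_add_one h.ne', show p - 2 + 1 = p - 1 by ring]

variable {n m : ℕ} {M : Type*} [TopologicalSpace M]
  [ChartedSpace (EuclideanSpace ℝ (Fin n)) M] [IsManifold (𝓡 n) ∞ M]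

local notation "𝔼" => EuclideanSpace ℝ (Fin n)

/-! ### Derivatives of mass and energy -/

theorem inner_grad_self_nonneg (g : Metric n M) (x : M) (v : TangentSpace (𝓡 n) x) :
    0 ≤ g.inner x v v := by
  by_cases h : v = 0
  · simp [h]
  · exact (g.pos x v h).le

theorem sum_inner_grad_nonneg (g : Metric n M) (u : M → EuclideanSpace ℝ (Fin m)) (x : M) :
    0 ≤ ∑ k, g.inner x (grad g (fun z => u z k) x) (grad g (fun z => u z k) x) :=
  Finset.sum_nonneg fun _ _ => inner_grad_self_nonneg g x _

theorem sq_gradNorm (g : Metric n M) (u : M → EuclideanSpace ℝ (Fin m)) (x : M) :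
    gradNorm g u x ^ 2 =
      ∑ k, g.inner x (grad g (fun z => u z k) x) (grad g (fun z => u z k) x) :=
  Real.sq_sqrt (sum_inner_grad_nonneg g u x)

theorem gradNorm_nonneg (g : Metric n M) (u : M → EuclideanSpace ℝ (Fin m)) (x : M) :
    0 ≤ gradNorm g u x := Real.sqrt_nonneg _

theorem grad_eq_zero_of_gradNorm (g : Metric n M) {u : M → EuclideanSpace ℝ (Fin m)} {x : M}
    (h : gradNorm g u x = 0) (k : Fin m) : grad g (fun z => u z k) x = 0 := by
  have h1 := sq_gradNorm g u x
  rw [h, zero_pow two_ne_zero, eq_comm,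
    Finset.sum_eq_zero_iff_of_nonneg fun _ _ => inner_grad_self_nonneg g x _] at h1
  by_contra hne
  exact (g.pos x _ hne).ne' (h1 k (Finset.mem_univ k))

theorem dirDeriv_flux (g : Metric n M) (p : ℝ) (u : M → EuclideanSpace ℝ (Fin m)) (k : Fin m)
    (φ : M → ℝ) (x : M) : dirDeriv (flux g p u k) φ x =
      gradNorm g u x ^ (p - 2) * g.inner x (grad g φ x) (grad g (fun z => u z k) x) := by
  have h := inner_grad g φ x (flux g p u k x)
  rw [flux, map_smul] at h
  exact h.symm

theorem sum_dirDeriv_flux_self (g : Metric n M) {p : ℝ} (hp : 1 < p)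
    (u : M → EuclideanSpace ℝ (Fin m)) (x : M) :
    ∑ k, dirDeriv (flux g p u k) (fun z => u z k) x = gradNorm g u x ^ p := by
  simp only [dirDeriv_flux, ← Finset.mul_sum, ← sq_gradNorm]
  rcases (gradNorm_nonneg g u x).eq_or_lt with h | h
  · rw [← h, Real.zero_rpow (by linarith : p ≠ 0)]
    simp
  · rw [← Real.rpow_natCast, ← Real.rpow_add h]
    congr 1
    push_cast
    ring

/-- A weak form of Cauchy–Schwarz, sufficient for domination. With N = |∇u|, expand ∑ |± N ∇v_k +
∇u_k|² ≥ 0 and divide by 2N. The factor N on the right turns |∇u|^{p-2} into the bounded |∇u|^{p-1}.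
-/
theorem abs_sum_inner_grad_le (g : Metric n M) (u v : M → EuclideanSpace ℝ (Fin m)) (x : M) :
    |∑ k, g.inner x (grad g (fun z => v z k) x) (grad g (fun z => u z k) x)| ≤
      gradNorm g u x * ((1 + gradNorm g v x ^ 2) / 2) := by
  set N := gradNorm g u x with hN
  rcases (gradNorm_nonneg g u x).eq_or_lt with h | h
  · rw [hN, ← h, zero_mul]
    simp [grad_eq_zero_of_gradNorm g h.symm]
  have key : ∀ e : ℝ, e ^ 2 = 1 →
      0 ≤ N ^ 2 * gradNorm g v x ^ 2 +
        2 * (e * N) * ∑ k, g.inner x (grad g (fun z => v z k) x) (grad g (fun z => u z k) x)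
        + ∑ k, g.inner x (grad g (fun z => u z k) x) (grad g (fun z => u z k) x) := by
    intro e he
    rw [sq_gradNorm g v x, Finset.mul_sum, Finset.mul_sum, ← Finset.sum_add_distrib,
      ← Finset.sum_add_distrib]
    refine Finset.sum_nonneg fun k _ => ?_
    have h1 := inner_grad_self_nonneg g x
      ((e * N) • grad g (fun z => v z k) x + grad g (fun z => u z k) x)
    have h2 := g.symm x (grad g (fun z => u z k) x) (grad g (fun z => v z k) x)
    simp only [map_add, map_smul, add_apply, smul_apply,
      smul_eq_mul] at h1
    rw [h2] at h1
    refine h1.trans (le_of_eq ?_)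
    linear_combination (N ^ 2 * g.inner x (grad g (fun z => v z k) x)
      (grad g (fun z => v z k) x)) * he
  have h1 := key 1 (by norm_num)
  have h2 := key (-1) (by norm_num)
  rw [← sq_gradNorm] at h1 h2
  refine abs_le.2 ⟨?_, ?_⟩
  · refine le_of_mul_le_mul_left ?_ h
    linarith
  · refine le_of_mul_le_mul_left ?_ h
    linarith

variable {a b : ℝ}

theorem IsSmoothFamily.apply {u : ℝ → M → EuclideanSpace ℝ (Fin m)}
    (hu : IsSmoothFamily n a b u) (k : Fin m) : IsSmoothFamily n a b fun s x => u s x k :=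
  fun c => (EuclideanSpace.proj (𝕜 := ℝ) (ι := Fin m) k).contDiff.comp_contDiffOn (hu c)

theorem timeDeriv_apply {u : ℝ → M → EuclideanSpace ℝ (Fin m)} (hab : a < b)
    (hu : IsSmoothFamily n a b u) {s : ℝ} (hs : s ∈ Icc a b) (k : Fin m) :
    timeDeriv a b (fun s x => u s x k) s = fun x => timeDeriv a b u s x k := by
  funext x
  exact ((EuclideanSpace.proj (𝕜 := ℝ) (ι := Fin m) k).hasFDerivAt.comp_hasDerivWithinAt
    s (hu.hasDerivWithinAt hs x)).derivWithin (uniqueDiffOn_Icc hab s hs)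

theorem continuousOn_sq_gradNorm (hab : a < b) (g : Metric n M)
    {u : ℝ → M → EuclideanSpace ℝ (Fin m)} (hu : IsSmoothFamily n a b u) :
    ContinuousOn (Function.uncurry fun s x => gradNorm g (u s) x ^ 2) (Icc a b ×ˢ univ) := by
  have h : ContinuousOn (fun q => ∑ k, Function.uncurry (fun s x =>
      g.inner x (grad g (fun z => u s z k) x) (grad g (fun z => u s z k) x)) q)
      (Icc a b ×ˢ univ) :=
    continuousOn_finsetSum _ fun k _ => continuousOn_inner_grad hab g (hu.apply k) (hu.apply k)
  refine h.congr fun z _ => ?_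
  exact sq_gradNorm g (u z.1) z.2

theorem continuous_gradNorm (hab : a < b) (g : Metric n M)
    {u : ℝ → M → EuclideanSpace ℝ (Fin m)} (hu : IsSmoothFamily n a b u) {s : ℝ}
    (hs : s ∈ Icc a b) : Continuous (gradNorm g (u s)) := by
  have h := (continuousOn_sq_gradNorm hab g hu).comp_continuous
    (Continuous.prodMk_right (X := ℝ) (Y := M) s) fun x => ⟨hs, mem_univ _⟩
  refine h.sqrt.congr fun x => Real.sqrt_sq (gradNorm_nonneg g _ x)

theorem hasDerivWithinAt_gradNorm_rpow (hab : a < b) (g : Metric n M) {p : ℝ} (hp : 1 < p)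
    {u : ℝ → M → EuclideanSpace ℝ (Fin m)} (hu : IsSmoothFamily n a b u) {s : ℝ}
    (hs : s ∈ Icc a b) (x : M) :
    HasDerivWithinAt (fun r => gradNorm g (u r) x ^ p)
      (p * ∑ k, dirDeriv (flux g p (u s) k) (fun z => timeDeriv a b u s z k) x) (Icc a b) s := by
  have h1 : HasDerivWithinAt
      (fun r => ∑ k, g.inner x (grad g (fun z => u r z k) x) (grad g (fun z => u r z k) x))
      (∑ k, 2 * g.inner x (grad g (fun z => timeDeriv a b u s z k) x)
        (grad g (fun z => u s z k) x)) (Icc a b) s := by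
    refine HasDerivWithinAt.fun_sum fun k _ => ?_
    have := hasDerivWithinAt_inner_grad hab g (hu.apply k) hs x
    rwa [timeDeriv_apply hab hu hs] at this
  have h2 := hasDerivWithinAt_sqrt_rpow hp (fun r => sum_inner_grad_nonneg g (u r) x) h1
    fun h0 => by
      have hz : gradNorm g (u s) x = 0 := by rw [gradNorm, h0, Real.sqrt_zero]
      refine ⟨Finset.sum_eq_zero fun k _ => ?_, Asymptotics.IsBigO.fun_sum fun k _ => ?_⟩
      · rw [grad_eq_zero_of_gradNorm g hz k, map_zero, mul_zero]
      · exact isBigO_inner_grad hab g (hu.apply k) hs x (grad_eq_zero_of_gradNorm g hz k)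
  refine h2.congr_deriv ?_
  simp only [dirDeriv_flux, ← Finset.mul_sum]
  rw [mul_div_cancel_left₀ _ two_ne_zero]
  rfl

theorem exists_bound_dirDeriv_flux [CompactSpace M] (hab : a < b) (g : Metric n M) {p : ℝ}
    (hp : 1 < p) {u : ℝ → M → EuclideanSpace ℝ (Fin m)} (hu : IsSmoothFamily n a b u) :
    ∃ C, ∀ s ∈ Icc a b, ∀ x,
      |p * ∑ k, dirDeriv (flux g p (u s) k) (fun z => timeDeriv a b u s z k) x| ≤ C := by
  obtain ⟨C₁, h₁⟩ := exists_bound_uncurry (continuousOn_sq_gradNorm hab g hu)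
  obtain ⟨C₂, h₂⟩ := exists_bound_uncurry (continuousOn_sq_gradNorm hab g (hu.timeDeriv hab))
  refine ⟨p * (√C₁ ^ (p - 1) * ((1 + C₂) / 2)), fun s hs x => ?_⟩
  simp only [dirDeriv_flux, ← Finset.mul_sum]
  have hN := gradNorm_nonneg g (u s) x
  have h3 : gradNorm g (u s) x ≤ √C₁ := Real.le_sqrt_of_sq_le ((le_abs_self _).trans (h₁ s hs x))
  have h4 : gradNorm g (timeDeriv a b u s) x ^ 2 ≤ C₂ := (le_abs_self _).trans (h₂ s hs x)
  rw [abs_mul, abs_of_pos (by linarith : 0 < p), abs_mul, abs_of_nonneg (Real.rpow_nonneg hN _)]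
  refine mul_le_mul_of_nonneg_left ?_ (by linarith)
  have h5 := abs_sum_inner_grad_le g (u s) (timeDeriv a b u s) x
  refine (mul_le_mul_of_nonneg_left h5 (Real.rpow_nonneg hN _)).trans ?_
  rw [← mul_assoc]
  refine mul_le_mul ?_ (by linarith) (by positivity) (by positivity)
  rcases hN.eq_or_lt with h | h
  · rw [← h, mul_zero]
    positivity
  · rw [← Real.rpow_add_one h.ne', show p - 2 + 1 = p - 1 by ring]
    exact Real.rpow_le_rpow hN h3 (by linarith)

variable [CompactSpace M] [T2Space M] [MeasurableSpace M] [BorelSpace M]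

theorem integrable_weightedVolume (g : Metric n M) {f : M → ℝ} (hf : Continuous f) {G : M → ℝ}
    (hG : Continuous G) : Integrable G (weightedVolume g f) := by
  have := isFiniteMeasure_weightedVolume g hf
  exact hG.integrable_of_hasCompactSupport (HasCompactSupport.of_compactSpace G)

theorem hasDerivWithinAt_integral_gradNorm (hab : a < b) (g : Metric n M) {f : M → ℝ}
    (hf : Continuous f) {p : ℝ} (hp : 1 < p) {u : ℝ → M → EuclideanSpace ℝ (Fin m)}
    (hu : IsSmoothFamily n a b u) {s : ℝ} (hs : s ∈ Icc a b) :
    HasDerivWithinAt (fun r => ∫ x, gradNorm g (u r) x ^ p ∂(weightedVolume g f))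
      (∫ x, p * ∑ k, dirDeriv (flux g p (u s) k) (fun z => timeDeriv a b u s z k) x
        ∂(weightedVolume g f)) (Icc a b) s := by
  have := isFiniteMeasure_weightedVolume g hf
  obtain ⟨C, hC⟩ := exists_bound_dirDeriv_flux hab g hp hu
  exact hasDerivWithinAt_integral_Icc (fun r hr => integrable_weightedVolume g hf
    ((continuous_gradNorm hab g hu hr).rpow_const fun x => Or.inr (by linarith)))
    (fun r hr x => hasDerivWithinAt_gradNorm_rpow hab g hp hu hr x) hC hs

theorem hasDerivWithinAt_mass (hab : a < b) (g : Metric n M) {f : M → ℝ}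
    (hf : Continuous f) {p : ℝ} (hp : 1 < p) {u : ℝ → M → EuclideanSpace ℝ (Fin m)}
    (hu : IsSmoothFamily n a b u) {s : ℝ} (hs : s ∈ Icc a b) :
    HasDerivWithinAt (fun r => mass g f p (u r))
      (∫ x, p * (‖u s x‖ ^ (p - 2) * inner ℝ (u s x) (timeDeriv a b u s x))
        ∂(weightedVolume g f)) (Icc a b) s := by
  have := isFiniteMeasure_weightedVolume g hf
  obtain ⟨C₁, h₁⟩ := exists_bound_uncurry (F := fun s x => ‖u s x‖) hu.continuousOn.norm
  obtain ⟨C₂, h₂⟩ := exists_bound_uncurry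
    (F := fun s x => ‖timeDeriv a b u s x‖) (hu.timeDeriv hab).continuousOn.norm
  refine hasDerivWithinAt_integral_Icc (C := p * (C₁ ^ (p - 1) * C₂)) (F := fun r x => ‖u r x‖ ^ p)
    (F' := fun r x => p * (‖u r x‖ ^ (p - 2) * inner ℝ (u r x) (timeDeriv a b u r x)))
    (fun r hr => integrable_weightedVolume g hf
    ((hu.contMDiff hr).continuous.norm.rpow_const fun x => Or.inr (by linarith)))
    (fun r hr x => ?_) (fun r hr x => ?_) hs
  · refine ((hasFDerivAt_norm_rpow (u r x) hp).comp_hasDerivWithinAt r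
      (hu.hasDerivWithinAt hr x)).congr_deriv ?_
    simp [mul_assoc]
  · have hN := norm_nonneg (u r x)
    have h3 : ‖u r x‖ ≤ C₁ := (le_abs_self _).trans (h₁ r hr x)
    have h4 : ‖timeDeriv a b u r x‖ ≤ C₂ := (le_abs_self _).trans (h₂ r hr x)
    rw [abs_mul, abs_of_pos (by linarith : 0 < p)]
    refine mul_le_mul_of_nonneg_left ?_ (by linarith)
    refine (abs_norm_rpow_mul_inner_le hp _ _).trans ?_
    have hC₁ : 0 ≤ C₁ := hN.trans h3
    exact mul_le_mul (Real.rpow_le_rpow hN h3 (by linarith)) h4 (norm_nonneg _) (by positivity)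

/-- Integration by parts against the weighted `p`-Laplacian. -/
theorem integral_inner_pLaplacian (g : Metric n M) {f : M → ℝ} (hf : ContMDiff (𝓡 n) 𝓘(ℝ, ℝ) 1 f)
    {p : ℝ} {u v : M → EuclideanSpace ℝ (Fin m)} (hX : ∀ k, IsC1Field (flux g p u k))
    (hv : ∀ k, ContMDiff (𝓡 n) 𝓘(ℝ, ℝ) 1 fun x => v x k) :
    ∫ x, inner ℝ (v x) (pLaplacian g f p u x) ∂(weightedVolume g f) =
      -∫ x, ∑ k, dirDeriv (flux g p u k) (fun z => v z k) x ∂(weightedVolume g f) := by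
  have h1 : ∀ x, inner ℝ (v x) (pLaplacian g f p u x) =
      ∑ k, v x k * weightedDiv g f (flux g p u k) x := fun x => by
    simp [PiLp.inner_apply, pLaplacian, mul_comm]
  simp only [h1]
  rw [integral_finsetSum, integral_finsetSum, ← Finset.sum_neg_distrib]
  · exact Finset.sum_congr rfl fun k _ => integral_mul_weightedDiv g hf (hX k) (hv k)
  · exact fun k _ => integrable_weightedVolume g hf.continuous (continuous_dirDeriv (hX k) (hv k))
  · exact fun k _ => integrable_weightedVolume g hf.continuous
      ((hv k).continuous.mul (continuous_weightedDiv g hf (hX k)))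

theorem energy_eq (g : Metric n M) {f : M → ℝ} (hf : ContMDiff (𝓡 n) 𝓘(ℝ, ℝ) 1 f)
    {p : ℝ} (hp : 1 < p) {u : M → EuclideanSpace ℝ (Fin m)}
    (hX : ∀ k, IsC1Field (flux g p u k)) (hu : ∀ k, ContMDiff (𝓡 n) 𝓘(ℝ, ℝ) 1 fun x => u x k) :
    energy g f p u = -∫ x, gradNorm g u x ^ p ∂(weightedVolume g f) := by
  rw [energy, integral_inner_pLaplacian g hf hX hu]
  simp only [sum_dirDeriv_flux_self g hp]

theorem IsSmoothFamily.contMDiff_apply {u : ℝ → M → EuclideanSpace ℝ (Fin m)}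
    (hu : IsSmoothFamily n a b u) {s : ℝ} (hs : s ∈ Icc a b) (k : Fin m) {r : WithTop ℕ∞}
    (hr : r ≤ ∞) : ContMDiff (𝓡 n) 𝓘(ℝ, ℝ) r fun x => u s x k :=
  ((hu.apply k).contMDiff hs).of_le hr

/-- The form -∫ |∇u|^p is differentiated rather than ∫ ⟨u, Δ_{f,p} u⟩: for p < 2 the flux is assumed
C^1 in space at each fixed time only, so the p-Laplacian need not be differentiable in time. A
second integration by parts, against u_t, brings it back. -/
theorem hasDerivWithinAt_energy (hab : a < b) (g : Metric n M) {f : M → ℝ}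
    (hf : ContMDiff (𝓡 n) 𝓘(ℝ, ℝ) 1 f) {p : ℝ} (hp : 1 < p)
    {u : ℝ → M → EuclideanSpace ℝ (Fin m)} (hu : IsSmoothFamily n a b u)
    (hX : ∀ s ∈ Icc a b, ∀ k, IsC1Field (flux g p (u s) k)) {s : ℝ} (hs : s ∈ Icc a b) :
    HasDerivWithinAt (fun r => energy g f p (u r))
      (p * ∫ x, inner ℝ (timeDeriv a b u s x) (pLaplacian g f p (u s) x) ∂(weightedVolume g f))
      (Icc a b) s := by
  have hone : (1 : WithTop ℕ∞) ≤ ∞ := WithTop.coe_le_coe.2 le_top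
  have he : ∀ r ∈ Icc a b, energy g f p (u r) =
      -∫ x, gradNorm g (u r) x ^ p ∂(weightedVolume g f) := fun r hr =>
    energy_eq g hf hp (hX r hr) fun k => hu.contMDiff_apply hr k hone
  refine ((hasDerivWithinAt_integral_gradNorm hab g hf.continuous hp hu hs).fun_neg.congr_deriv
    ?_).congr he (he s hs)
  rw [integral_inner_pLaplacian g hf (hX s hs)
    fun k => (hu.timeDeriv hab).contMDiff_apply hs k hone, integral_const_mul, mul_neg]

end WeightedPHeat

namespace WeightedPHeat

open Filter Topology Bundle
/-! ### Pointwise consequences of the differential inequality -/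

section Pointwise

variable {E : Type*} [NormedAddCommGroup E] [InnerProductSpace ℝ E] {u v L : E} {p c N : ℝ}

theorem norm_rpow_mul_sqrt (hu : u ≠ 0) (hN : 0 ≤ N) :
    ‖u‖ ^ p * (‖u‖ ^ (-p / 2) * √(N ^ p)) ^ 2 = N ^ p := by
  have h : 0 < ‖u‖ := norm_pos_iff.2 hu
  rw [mul_pow, Real.sq_sqrt (Real.rpow_nonneg hN p), ← mul_assoc, ← Real.rpow_natCast,
    ← Real.rpow_mul h.le, ← Real.rpow_add h]
  simp

theorem norm_rpow_eq (hu : u ≠ 0) : ‖u‖ ^ p = ‖u‖ ^ (p - 2) * ‖u‖ ^ 2 := by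
  have h : 0 < ‖u‖ := norm_pos_iff.2 hu
  rw [← Real.rpow_natCast, ← Real.rpow_add h]
  simp

theorem norm_rpow_eq_mul (hu : u ≠ 0) : ‖u‖ ^ p = ‖u‖ ^ (p - 1) * ‖u‖ := by
  rw [← Real.rpow_add_one (norm_ne_zero_iff.2 hu)]
  simp

/-- The completed square of the argument, with `v` for u_t and a free parameter `l`. As `l` is a
constant, the inequality can be integrated before `l` is set equal to the frequency. -/
theorem le_inner_sub_of_norm_sub_le (hu : u ≠ 0) (hN : 0 ≤ N)
    (h : ‖‖u‖ ^ (p - 2) • v - L‖ ≤ c * (‖u‖ ^ (p - 1) * (1 + ‖u‖ ^ (-p / 2) * √(N ^ p)))) (l : ℝ) :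
    -(c ^ 2 / 2) * (‖u‖ ^ p + N ^ p) ≤
      inner ℝ v L - l * (‖u‖ ^ (p - 2) * inner ℝ u v + inner ℝ u L) + l ^ 2 * ‖u‖ ^ p := by
  have hw : 0 < ‖u‖ ^ (p - 2) := Real.rpow_pos_of_pos (norm_pos_iff.2 hu) _
  have hz := norm_rpow_mul_sqrt (p := p) hu hN
  have h1 := norm_rpow_eq (p := p) hu
  have h2 := norm_rpow_eq_mul (p := p) hu
  have h3 := norm_rpow_eq_mul (p := p - 1) hu
  rw [show p - 1 - 1 = p - 2 by ring] at h3
  set w := ‖u‖ ^ (p - 2)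
  set z := ‖u‖ ^ (-p / 2) * √(N ^ p)
  obtain ⟨E, hE⟩ : ∃ E, E = w • v - L := ⟨_, rfl⟩
  rw [← hE] at h
  -- Here |u|^{2(p-1)} = w |u|^p and |u|^p z² = N^p, so (1 + z)² ≤ 2 (1 + z²) gives the bound.
  have hsq : ‖E‖ ^ 2 ≤ c ^ 2 * (w * (2 * (‖u‖ ^ p + N ^ p))) := by
    refine (pow_le_pow_left₀ (norm_nonneg _) h 2).trans ?_
    have h4 : (c * (‖u‖ ^ (p - 1) * (1 + z))) ^ 2 = c ^ 2 * (w * (‖u‖ ^ p * (1 + z) ^ 2)) := by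
      rw [h2, h3]
      ring
    rw [h4]
    have h5 : ‖u‖ ^ p * (1 + z) ^ 2 ≤ 2 * (‖u‖ ^ p + N ^ p) := by
      rw [← hz]
      have := mul_nonneg (Real.rpow_nonneg (norm_nonneg u) p) (sq_nonneg (1 - z))
      linarith
    gcongr
  have hv : w • v = L + E := by rw [hE]; abel
  have hvL : w * inner ℝ v L = inner ℝ L L + inner ℝ E L := by
    rw [← real_inner_smul_left, hv, inner_add_left]
  have huv : w * inner ℝ u v = inner ℝ u L + inner ℝ u E := by
    rw [← real_inner_smul_right, hv, inner_add_right]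
  -- The coefficient 1/2 reproduces both cross terms ⟨E, L⟩ and -l w ⟨u, E⟩ exactly and leaves only
  -- |E|²/4 as surplus.
  have hpos : 0 ≤ inner ℝ (L + (1 / 2 : ℝ) • E - (l * w) • u) (L + (1 / 2 : ℝ) • E - (l * w) • u) :=
    real_inner_self_nonneg
  simp only [inner_add_left, inner_add_right, inner_sub_left, inner_sub_right,
    real_inner_smul_left, real_inner_smul_right] at hpos
  rw [real_inner_comm E L, real_inner_comm u L, real_inner_comm u E, real_inner_self_eq_norm_sq u,
    real_inner_self_eq_norm_sq E] at hpos
  refine le_of_mul_le_mul_left ?_ hw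
  have e1 : w * (l ^ 2 * ‖u‖ ^ p) = (l * w) * (l * w * ‖u‖ ^ 2) := by rw [h1]; ring
  rw [huv, mul_add w, mul_sub w, hvL, e1]
  rw [real_inner_self_eq_norm_sq L] at *
  linarith

/-- Cauchy–Schwarz for ⟨u, E⟩, followed by z ≤ (1 + z²)/2; this is the origin of the constants 3/2
and 1/2. -/
theorem inner_sub_le_of_norm_sub_le (hu : u ≠ 0) (hN : 0 ≤ N) (hc : 0 ≤ c)
    (h : ‖‖u‖ ^ (p - 2) • v - L‖ ≤ c * (‖u‖ ^ (p - 1) * (1 + ‖u‖ ^ (-p / 2) * √(N ^ p)))) :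
    inner ℝ u L - c * (3 / 2 * ‖u‖ ^ p + 1 / 2 * N ^ p) ≤ ‖u‖ ^ (p - 2) * inner ℝ u v := by
  have hz := norm_rpow_mul_sqrt (p := p) hu hN
  have h2 := norm_rpow_eq_mul (p := p) hu
  set z := ‖u‖ ^ (-p / 2) * √(N ^ p)
  have h3 : inner ℝ u L - ‖u‖ ^ (p - 2) * inner ℝ u v ≤ ‖u‖ * ‖‖u‖ ^ (p - 2) • v - L‖ := by
    have := (abs_le.1 (abs_real_inner_le_norm u (‖u‖ ^ (p - 2) • v - L))).1
    rw [inner_sub_right, real_inner_smul_right] at this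
    linarith
  have h4 : ‖u‖ * (c * (‖u‖ ^ (p - 1) * (1 + z))) = c * (‖u‖ ^ p * (1 + z)) := by
    rw [h2]
    ring
  have h5 : ‖u‖ ^ p * (1 + z) ≤ 3 / 2 * ‖u‖ ^ p + 1 / 2 * N ^ p := by
    rw [← hz]
    have := mul_nonneg (Real.rpow_nonneg (norm_nonneg u) p) (sq_nonneg (1 - z))
    linarith
  have h6 := mul_le_mul_of_nonneg_left h (norm_nonneg u)
  have h7 := mul_le_mul_of_nonneg_left h5 hc
  linarith

end Pointwise

variable {n m : ℕ} {M : Type*} [TopologicalSpace M]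
  [ChartedSpace (EuclideanSpace ℝ (Fin n)) M] [IsManifold (𝓡 n) ∞ M]
  [CompactSpace M] [T2Space M] [MeasurableSpace M] [BorelSpace M]

/-! ### Integrated inequalities -/

theorem mass_pos (g : Metric n M) {f : M → ℝ} (hf : Continuous f) {p : ℝ} (hp : 1 < p)
    {u : M → EuclideanSpace ℝ (Fin m)} (hu : Continuous u) (h : ∃ x, u x ≠ 0) :
    0 < mass g f p u := by
  have := isFiniteMeasure_weightedVolume g hf
  have := isOpenPosMeasure_weightedVolume g hf
  obtain ⟨x, hx⟩ := h
  exact (hu.norm.rpow_const fun x => Or.inr (by linarith)).integral_pos_of_hasCompactSupport_nonneg_nonzero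
    (HasCompactSupport.of_compactSpace _) (fun x => by positivity)
    (x := x) (Real.rpow_pos_of_pos (norm_pos_iff.2 hx) p).ne'

theorem integrable_norm_rpow_mul_inner (g : Metric n M) {f : M → ℝ} (hf : Continuous f) {p : ℝ}
    (hp : 1 < p) {u v : M → EuclideanSpace ℝ (Fin m)} (hu : Continuous u) (hv : Continuous v) :
    Integrable (fun x => ‖u x‖ ^ (p - 2) * inner ℝ (u x) (v x)) (weightedVolume g f) := by
  refine Integrable.mono' (integrable_weightedVolume g hf
    ((hu.norm.rpow_const fun x => Or.inr (by linarith : 0 ≤ p - 1)).mul hv.norm)) ?_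
    (Eventually.of_forall fun x => abs_norm_rpow_mul_inner_le hp _ _)
  exact ((hu.norm.measurable.pow_const _).mul (hu.inner hv).measurable).aestronglyMeasurable

section Integrated

variable {g : Metric n M} {f : M → ℝ} {p c : ℝ} {u v : M → EuclideanSpace ℝ (Fin m)}

/-- The integrated form of `le_inner_sub_of_norm_sub_le`. -/
theorem le_integral_inner_sub (hf : ContMDiff (𝓡 n) 𝓘(ℝ, ℝ) 1 f) (hp : 1 < p)
    (hu : ∀ k, ContMDiff (𝓡 n) 𝓘(ℝ, ℝ) 1 fun x => u x k) (huc : Continuous u) (hv : Continuous v)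
    (hN : Continuous (gradNorm g u)) (hX : ∀ k, IsC1Field (flux g p u k))
    (h : ∀ x, u x ≠ 0 → ‖‖u x‖ ^ (p - 2) • v x - pLaplacian g f p u x‖ ≤
      c * (‖u x‖ ^ (p - 1) * (1 + ‖u x‖ ^ (-p / 2) * √(gradNorm g u x ^ p)))) (l : ℝ) :
    -(c ^ 2 / 2) * (mass g f p u - energy g f p u) ≤
      ∫ x, inner ℝ (v x) (pLaplacian g f p u x) ∂(weightedVolume g f)
      - l * (∫ x, ‖u x‖ ^ (p - 2) * inner ℝ (u x) (v x) ∂(weightedVolume g f) + energy g f p u)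
      + l ^ 2 * mass g f p u := by
  have hL := continuous_pLaplacian g hf hX
  have i1 : Integrable (fun x => inner ℝ (v x) (pLaplacian g f p u x)) (weightedVolume g f) :=
    integrable_weightedVolume g hf.continuous (hv.inner hL)
  have i2 := integrable_norm_rpow_mul_inner g hf.continuous hp huc hv
  have i3 : Integrable (fun x => inner ℝ (u x) (pLaplacian g f p u x)) (weightedVolume g f) :=
    integrable_weightedVolume g hf.continuous (huc.inner hL)
  have i4 : Integrable (fun x => ‖u x‖ ^ p) (weightedVolume g f) :=
    integrable_weightedVolume g hf.continuous
      (huc.norm.rpow_const fun x => Or.inr (by linarith))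
  have i5 : Integrable (fun x => gradNorm g u x ^ p) (weightedVolume g f) :=
    integrable_weightedVolume g hf.continuous (hN.rpow_const fun x => Or.inr (by linarith))
  -- Where u = 0 the right side reduces to ⟨v, L⟩, which has no sign in general but is zero almost
  -- everywhere there; the left side is nonpositive.
  have key := integral_mono_ae ((i4.add i5).const_mul (-(c ^ 2 / 2)))
    ((i1.sub ((i2.add i3).const_mul l)).add (i4.const_mul (l ^ 2))) (by
      filter_upwards [ae_pLaplacian_eq_zero g hf hu hX] with x hx
      by_cases hux : u x = 0
      · have h0 : 0 ≤ c ^ 2 / 2 * gradNorm g u x ^ p :=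
          mul_nonneg (by positivity) (Real.rpow_nonneg (gradNorm_nonneg g u x) p)
        simp [hux, hx hux, Real.zero_rpow (by linarith : p ≠ 0), h0]
      · exact le_inner_sub_of_norm_sub_le hux (gradNorm_nonneg g u x) (h x hux) l)
  have j1 : Integrable (fun x => ‖u x‖ ^ (p - 2) * inner ℝ (u x) (v x) +
      inner ℝ (u x) (pLaplacian g f p u x)) (weightedVolume g f) := i2.add i3
  have j2 : Integrable (fun x => inner ℝ (v x) (pLaplacian g f p u x) -
      l * (‖u x‖ ^ (p - 2) * inner ℝ (u x) (v x) + inner ℝ (u x) (pLaplacian g f p u x)))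
      (weightedVolume g f) := i1.sub (j1.const_mul l)
  have e1 : ∫ x, -(c ^ 2 / 2) * (‖u x‖ ^ p + gradNorm g u x ^ p) ∂(weightedVolume g f) =
      -(c ^ 2 / 2) * (mass g f p u + ∫ x, gradNorm g u x ^ p ∂(weightedVolume g f)) := by
    rw [integral_const_mul, integral_add i4 i5]
    rfl
  have e2 : ∫ x, (inner ℝ (v x) (pLaplacian g f p u x) - l * (‖u x‖ ^ (p - 2) *
      inner ℝ (u x) (v x) + inner ℝ (u x) (pLaplacian g f p u x)) + l ^ 2 * ‖u x‖ ^ p)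
      ∂(weightedVolume g f) =
      ∫ x, inner ℝ (v x) (pLaplacian g f p u x) ∂(weightedVolume g f)
      - l * (∫ x, ‖u x‖ ^ (p - 2) * inner ℝ (u x) (v x) ∂(weightedVolume g f) + energy g f p u)
      + l ^ 2 * mass g f p u := by
    rw [integral_add j2 (i4.const_mul _), integral_sub i1 (j1.const_mul l), integral_const_mul,
      integral_add i2 i3, integral_const_mul]
    rfl
  have h1 := energy_eq g hf hp hX hu
  refine le_trans (le_of_eq ?_) (key.trans (le_of_eq e2))
  refine Eq.trans ?_ e1.symm
  linear_combination (c ^ 2 / 2) * h1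

theorem energy_sub_le_integral (hf : ContMDiff (𝓡 n) 𝓘(ℝ, ℝ) 1 f) (hp : 1 < p) (hc : 0 ≤ c)
    (hu : ∀ k, ContMDiff (𝓡 n) 𝓘(ℝ, ℝ) 1 fun x => u x k) (huc : Continuous u) (hv : Continuous v)
    (hN : Continuous (gradNorm g u)) (hX : ∀ k, IsC1Field (flux g p u k))
    (h : ∀ x, u x ≠ 0 → ‖‖u x‖ ^ (p - 2) • v x - pLaplacian g f p u x‖ ≤
      c * (‖u x‖ ^ (p - 1) * (1 + ‖u x‖ ^ (-p / 2) * √(gradNorm g u x ^ p)))) :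
    energy g f p u - c * (3 / 2 * mass g f p u - 1 / 2 * energy g f p u) ≤
      ∫ x, ‖u x‖ ^ (p - 2) * inner ℝ (u x) (v x) ∂(weightedVolume g f) := by
  have hL := continuous_pLaplacian g hf hX
  have i2 := integrable_norm_rpow_mul_inner g hf.continuous hp huc hv
  have i3 : Integrable (fun x => inner ℝ (u x) (pLaplacian g f p u x)) (weightedVolume g f) :=
    integrable_weightedVolume g hf.continuous (huc.inner hL)
  have i4 : Integrable (fun x => ‖u x‖ ^ p) (weightedVolume g f) :=
    integrable_weightedVolume g hf.continuous
      (huc.norm.rpow_const fun x => Or.inr (by linarith))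
  have i5 : Integrable (fun x => gradNorm g u x ^ p) (weightedVolume g f) :=
    integrable_weightedVolume g hf.continuous (hN.rpow_const fun x => Or.inr (by linarith))
  have key := integral_mono_ae
    (i3.sub (((i4.const_mul (3 / 2)).add (i5.const_mul (1 / 2))).const_mul c)) i2
    (Eventually.of_forall fun x => by
      by_cases hux : u x = 0
      · have h0 : 0 ≤ c * (1 / 2 * gradNorm g u x ^ p) := mul_nonneg hc
          (mul_nonneg (by norm_num) (Real.rpow_nonneg (gradNorm_nonneg g u x) p))
        simpa [hux, Real.zero_rpow (by linarith : p ≠ 0)] using h0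
      · exact inner_sub_le_of_norm_sub_le hux (gradNorm_nonneg g u x) hc (h x hux))
  have e : ∫ x, (inner ℝ (u x) (pLaplacian g f p u x) -
      c * (3 / 2 * ‖u x‖ ^ p + 1 / 2 * gradNorm g u x ^ p)) ∂(weightedVolume g f) =
      energy g f p u - c * (3 / 2 * mass g f p u + 1 / 2 *
        ∫ x, gradNorm g u x ^ p ∂(weightedVolume g f)) := by
    have j : Integrable (fun x => 3 / 2 * ‖u x‖ ^ p + 1 / 2 * gradNorm g u x ^ p)
        (weightedVolume g f) := (i4.const_mul _).add (i5.const_mul _)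
    rw [integral_sub i3 (j.const_mul c), integral_const_mul,
      integral_add (i4.const_mul _) (i5.const_mul _), integral_const_mul, integral_const_mul]
    rfl
  have h1 := energy_eq g hf hp hX hu
  refine le_trans (le_of_eq ?_) key
  refine Eq.trans ?_ e.symm
  linear_combination (c / 2) * h1

end Integrated

/-! ### The quotient rule for the frequency and the conclusion -/

theorem hasDerivWithinAt_frequency {I D : ℝ → ℝ} {I' D' s : ℝ} {S : Set ℝ} {c p : ℝ} (hp : 1 < p)
    (hI : HasDerivWithinAt I (p * I') S s) (hD : HasDerivWithinAt D (p * D') S s)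
    (hpos : 0 < I s)
    (h : ∀ l : ℝ, -(c ^ 2 / 2) * (I s - D s) ≤ D' - l * (I' + D s) + l ^ 2 * I s) :
    ∃ U', HasDerivWithinAt (fun r => D r / I r) U' S s ∧
      p / 2 * c ^ 2 * (D s / I s - 1) ≤ U' := by
  refine ⟨_, hD.fun_div hI hpos.ne', ?_⟩
  -- With l = U = D/I one has l D = l² I, so these terms cancel and D' - U I' remains, which is the
  -- numerator in the quotient rule up to the factor p/I.
  have h1 := h (D s / I s)
  have h2 : D s / I s * I s = D s := div_mul_cancel₀ _ hpos.ne'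
  set U := D s / I s
  have h3 : (p * D' * I s - D s * (p * I')) / I s ^ 2 = p * (D' - U * I') / I s := by
    rw [← h2]
    field_simp
  rw [h3, le_div_iff₀ hpos]
  rw [← h2] at h1
  nlinarith

theorem flux_isC1Field {g : Metric n M} {p : ℝ} {u : M → EuclideanSpace ℝ (Fin m)}
    (hu : ∀ k, ContMDiff (𝓡 n) 𝓘(ℝ, ℝ) ∞ fun x => u x k)
    (h : p < 2 → ∀ k, IsC1Field (flux g p u k)) (k : Fin m) : IsC1Field (flux g p u k) :=
  (lt_or_ge p 2).elim (fun hp => h hp k) fun hp => isC1Field_flux g hp hu k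

end WeightedPHeat

theorem mainTheorem7 {n m : ℕ} {M : Type*} [TopologicalSpace M] [T2Space M] [CompactSpace M]
    [ChartedSpace (EuclideanSpace ℝ (Fin n)) M] [IsManifold (𝓡 n) ∞ M]
    [MeasurableSpace M] [BorelSpace M]
    (g : WeightedPHeat.Metric n M) (f : M → ℝ) (hf : ContMDiff (𝓡 n) 𝓘(ℝ, ℝ) 2 f)
    (p : ℝ) (hp : 1 < p) (a b : ℝ) (hab : a < b) (ψ : ℝ → ℝ)
    (u : ℝ → M → EuclideanSpace ℝ (Fin m))
    (hu : ContMDiffOn (𝓘(ℝ, ℝ).prod (𝓡 n)) 𝓘(ℝ, EuclideanSpace ℝ (Fin m)) ∞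
      (Function.uncurry u) (Icc a b ×ˢ univ))
    -- for `p < 2`: the field `|∇u|^{p-2} ∇u` is `C^1`, so that its divergence makes sense
    (hflux : p < 2 → ∀ t ∈ Icc a b, ∀ k : Fin m,
      ContMDiff (𝓡 n) (𝓡 n).tangent 1
        (fun x => (⟨x, WeightedPHeat.flux g p (u t) k x⟩ : TangentBundle (𝓡 n) M)))
    -- the differential inequality, at the points where the powers of `|u|` are defined
    (hineq : ∀ t ∈ Icc a b, ∀ x, u t x ≠ 0 →
      ‖‖u t x‖ ^ (p - 2) • derivWithin (fun s => u s x) (Icc a b) t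
          - WeightedPHeat.pLaplacian g f p (u t) x‖
        ≤ ψ t * (‖u t x‖ ^ (p - 1) *
            (1 + ‖u t x‖ ^ (-p / 2) * √(WeightedPHeat.gradNorm g (u t) x ^ p)))) :
    ∀ t ∈ Icc a b, (∃ x, u t x ≠ 0) →
      -- `I_p(t) > 0`, and the two expressions for `D_p(t)` agree
      0 < WeightedPHeat.mass g f p (u t) ∧
      WeightedPHeat.energy g f p (u t) =
        -∫ x, WeightedPHeat.gradNorm g (u t) x ^ p ∂(WeightedPHeat.weightedVolume g f) ∧
      -- `U_p' ≥ (p/2) ψ² (U_p - 1)`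
      DifferentiableWithinAt ℝ (fun s => WeightedPHeat.frequency g f p (u s)) (Icc a b) t ∧
      derivWithin (fun s => WeightedPHeat.frequency g f p (u s)) (Icc a b) t
        ≥ p / 2 * ψ t ^ 2 * (WeightedPHeat.frequency g f p (u t) - 1) ∧
      -- `ψ² ≥ (2/p) [log (1 - U_p)]'`
      DifferentiableWithinAt ℝ
        (fun s => Real.log (1 - WeightedPHeat.frequency g f p (u s))) (Icc a b) t ∧
      ψ t ^ 2 ≥ 2 / p * derivWithin
        (fun s => Real.log (1 - WeightedPHeat.frequency g f p (u s))) (Icc a b) t ∧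
      -- `[log I_p]' ≥ p (1 + ψ/2) U_p - (3p/2) ψ`
      DifferentiableWithinAt ℝ
        (fun s => Real.log (WeightedPHeat.mass g f p (u s))) (Icc a b) t ∧
      derivWithin (fun s => Real.log (WeightedPHeat.mass g f p (u s))) (Icc a b) t
        ≥ p * (1 + ψ t / 2) * WeightedPHeat.frequency g f p (u t) - 3 * p / 2 * ψ t := by
  intro t ht hne
  have hu' : WeightedPHeat.IsSmoothFamily n a b u := WeightedPHeat.isSmoothFamily_of_contMDiffOn hu
  have hone : (1 : WithTop ℕ∞) ≤ ∞ := WithTop.coe_le_coe.2 le_top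
  have hf1 : ContMDiff (𝓡 n) 𝓘(ℝ, ℝ) 1 f := hf.of_le one_le_two
  have hX : ∀ s ∈ Icc a b, ∀ k, WeightedPHeat.IsC1Field (WeightedPHeat.flux g p (u s) k) :=
    fun s hs k => WeightedPHeat.flux_isC1Field (fun k => hu'.contMDiff_apply hs k le_rfl)
      (fun hp2 k => hflux hp2 s hs k) k
  have hut : ∀ k, ContMDiff (𝓡 n) 𝓘(ℝ, ℝ) 1 fun x => u t x k := fun k =>
    hu'.contMDiff_apply ht k hone
  have huc : Continuous (u t) := (hu'.contMDiff ht).continuous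
  have hvc : Continuous (WeightedPHeat.timeDeriv a b u t) :=
    ((hu'.timeDeriv hab).contMDiff ht).continuous
  have hN := WeightedPHeat.continuous_gradNorm hab g hu' ht
  -- No sign of ψ is assumed: at a point with u ≠ 0 the right side of the differential inequality
  -- bounds a norm, and the factor multiplying ψ is positive.
  have hψ : 0 ≤ ψ t := by
    obtain ⟨x, hx⟩ := hne
    have h1 := (norm_nonneg _).trans (hineq t ht x hx)
    have h2 : 0 < ‖u t x‖ := norm_pos_iff.2 hx
    exact nonneg_of_mul_nonneg_left h1 (by positivity)
  have hpos := WeightedPHeat.mass_pos g hf.continuous hp huc hne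
  have hen := WeightedPHeat.energy_eq g hf1 hp (hX t ht) hut
  have hen0 : WeightedPHeat.energy g f p (u t) ≤ 0 := by
    rw [hen]
    exact neg_nonpos.2 (integral_nonneg fun x =>
      Real.rpow_nonneg (WeightedPHeat.gradNorm_nonneg g (u t) x) p)
  have hI := WeightedPHeat.hasDerivWithinAt_mass hab g hf.continuous hp hu' ht
  rw [integral_const_mul] at hI
  have hD := WeightedPHeat.hasDerivWithinAt_energy hab g hf1 hp hu' hX ht
  obtain ⟨U', hU, hU'⟩ := WeightedPHeat.hasDerivWithinAt_frequency hp hI hD hpos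
    (WeightedPHeat.le_integral_inner_sub hf1 hp hut huc hvc hN (hX t ht) (hineq t ht))
  have hJ := WeightedPHeat.energy_sub_le_integral hf1 hp hψ hut huc hvc hN (hX t ht) (hineq t ht)
  have huniq := uniqueDiffOn_Icc hab t ht
  -- Since D ≤ 0 < I, one has 1 - U ≥ 1, so the logarithm is differentiable and the inequality for
  -- U' may be divided by 1 - U.
  have hU0 : WeightedPHeat.frequency g f p (u t) ≤ 0 := div_nonpos_of_nonpos_of_nonneg hen0 hpos.le
  have hlog := (hU.const_sub 1).log (by
    change 1 - WeightedPHeat.frequency g f p (u t) ≠ 0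
    linarith)
  have hlogI := hI.log hpos.ne'
  refine ⟨hpos, hen, hU.differentiableWithinAt, ?_, hlog.differentiableWithinAt, ?_,
    hlogI.differentiableWithinAt, ?_⟩
  · exact hU'.trans_eq (hU.derivWithin huniq).symm
  · refine le_trans (le_of_eq (congrArg _ (hlog.derivWithin huniq))) ?_
    change 2 / p * (-U' / (1 - WeightedPHeat.frequency g f p (u t))) ≤ ψ t ^ 2
    change p / 2 * ψ t ^ 2 * (WeightedPHeat.frequency g f p (u t) - 1) ≤ U' at hU'
    have h1 : 0 < 1 - WeightedPHeat.frequency g f p (u t) := by linarith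
    rw [div_mul_div_comm, div_le_iff₀ (mul_pos (by linarith) h1)]
    linarith
  · rw [ge_iff_le, hlogI.derivWithin huniq, WeightedPHeat.frequency, le_div_iff₀ hpos]
    have h1 : WeightedPHeat.energy g f p (u t) / WeightedPHeat.mass g f p (u t) *
      WeightedPHeat.mass g f p (u t) = WeightedPHeat.energy g f p (u t) :=
      div_mul_cancel₀ _ hpos.ne'
    have h2 := mul_le_mul_of_nonneg_left hJ (by linarith : 0 ≤ p)
    rw [sub_mul, mul_assoc, h1]
    linarith
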